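/- **Setting.** For a semi-Riemannian manifold $(M,g)$ and smooth $\phi,\psi:M\to\mathbb C$ let $\tau(\phi)=\operatorname{trace}_g\nabla d\phi$ be the complex-valued Laplacian and $\kappa(\phi,\psi)=g(\operatorname{grad}\phi,\operatorname{grad}\psi)$, where $g$ is extended complex bilinearly. A family $\mathcal E$ of functions $M\to\mathbb C$ is an *eigenfamily* with eigenvalues $\lambda,\mu\in\mathbb C$ if $\tau(\phi)=\lambda\phi$ and $\kappa(\phi,\psi)=\mu\,\phi\psi$ for all $\phi,\psi\in\mathcal E$; it is an *eigenfamily* if this holds for some $\lambda,\mu\in\mathbb C$. Let $G$ be a non-compact real Lie group with semisimple Lie algebra $\mathfrak g$, let $\mathfrak g=\mathfrak k+\mathfrak p$ be a Cartan decomposition, and let $B$ be a scalar product on $\mathfrak g$ which is negative definite on $\mathfrak k$, positive definite on $\mathfrak p$ and satisfies $B(\mathfrak k,\mathfrak p)=0$. Equip $G$ with the left-invariant semi-Riemannian metric induced by $B$. Let $G^{\mathbb C}$ be a complexification of $G$, that is, a complex Lie group containing $G$ as an immersed real Lie subgroup, whose Lie algebra is $\mathfrak g^{\mathbb C}=\mathfrak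 g\oplus i\mathfrak g$. Let $U\subset G^{\mathbb C}$ be a compact dual of $G$, that is, a compact immersed real Lie subgroup with Lie algebra $\mathfrak u=\mathfrak k+i\mathfrak p$, equipped with the dual left-invariant Riemannian metric, which is induced by the restriction of $-\operatorname{Re}B^{\mathbb C}$ to $\mathfrak u$, where $B^{\mathbb C}$ is the complex bilinear extension of $B$ to $\mathfrak g^{\mathbb C}$. (So the new scalar product is $-B(Y,Y')$ on $\mathfrak k$ and $B(X,X')$ for $iX,iX'\in i\mathfrak p$, and $\mathfrak k\perp i\mathfrak p$.) Let $\mathcal E=(\phi_a)_{a\in A}$ be a family of real-analytic functions $\phi_a:W\to\mathbb C$ on an open set $W\subset G$. Let $W^{\mathbb C}\subset G^{\mathbb C}$ be an open set containing $W$, each connected component of which meets $W$, such that each $\phi_a$ extends to a holomorphic function $\phi_a^{\mathbb C}:W^{\mathbb C}\to\mathbb C$ (this extension is then unique). Put $W^*=U\cap W^{\mathbb C}$, $\phi_a^*=\phi_a^{\mathbb C}|_{W^*}$ and $\mathcal E^*=(\phi_a^*)_{a\in A}$. **Theorem 7.1.** Let $\lambda,\mu\in\mathbb C$. 1. If $\mathcal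 E$ is an eigenfamily on $W$ with eigenvalues $\lambda,\mu$, then $\mathcal E^*$ is an eigenfamily on $W^*$ with eigenvalues $-\lambda,-\mu$. 2. If moreover every connected component of $W^{\mathbb C}$ meets $U$, then $\mathcal E$ is an eigenfamily on $W$ with eigenvalues $\lambda,\mu$ if and only if $\mathcal E^*$ is an eigenfamily on $W^*$ with eigenvalues $-\lambda,-\mu$. In particular, $\mathcal E$ is an eigenfamily if and only if $\mathcal E^*$ is an eigenfamily. -/

import Mathlib

open scoped Manifold ContDiff

noncomputable section

/-! ### Laplacian and conformality operator of a semi-Riemannian metric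

`M` is a manifold without boundary, modelled on a finite-dimensional real normed space `E`.  A metric
is a field of bilinear forms on the tangent spaces.  All formulas are the classical ones in the local
coordinates given by the preferred chart at the point and a basis of `E`. -/

section SemiRiemannian

variable {E : Type*} [NormedAddCommGroup E] [NormedSpace ℝ E] [FiniteDimensional ℝ E]
variable {M : Type*} [TopologicalSpace M] [ChartedSpace E M]

/-- A field of bilinear forms on the tangent spaces of `M`. -/
abbrev MetricField (E : Type*) [NormedAddCommGroup E] [NormedSpace ℝ E]
    (M : Type*) [TopologicalSpace M] [ChartedSpace E M] : Type _ :=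
  ∀ x : M, LinearMap.BilinForm ℝ (TangentSpace 𝓘(ℝ, E) x)

/-- The partial derivative `∂ᵢ f` on the model space `E`, with respect to the coordinates of a
fixed basis of `E`. -/
def partialDeriv {F : Type*} [NormedAddCommGroup F] [NormedSpace ℝ F]
    (i : Fin (Module.finrank ℝ E)) (f : E → F) (y : E) : F :=
  fderiv ℝ f y (Module.finBasis ℝ E i)

/-- The function `φ` read in the preferred chart at `x₀`. -/
def chartRep (φ : M → ℂ) (x₀ : M) (y : E) : ℂ :=
  φ ((extChartAt 𝓘(ℝ, E) x₀).symm y)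

/-- The coordinate vector `∂ᵢ` of the preferred chart at `x₀`, as a tangent vector of `M` at the
point with coordinates `y`. -/
def coordVector (x₀ : M) (y : E) (i : Fin (Module.finrank ℝ E)) :
    TangentSpace 𝓘(ℝ, E) ((extChartAt 𝓘(ℝ, E) x₀).symm y) :=
  mfderiv 𝓘(ℝ, E) 𝓘(ℝ, E) (extChartAt 𝓘(ℝ, E) x₀).symm y (Module.finBasis ℝ E i)

/-- The components `g_{ij}(y)` of the metric in the preferred chart at `x₀`. -/
def metricMatrix (g : MetricField E M) (x₀ : M) (y : E) :
    Matrix (Fin (Module.finrank ℝ E)) (Fin (Module.finrank ℝ E)) ℝ :=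
  Matrix.of fun i j => g ((extChartAt 𝓘(ℝ, E) x₀).symm y) (coordVector x₀ y i) (coordVector x₀ y j)

/-- The Christoffel symbols
`Γᵏᵢⱼ = ½ ∑ₗ gᵏˡ (∂ᵢ g_{jl} + ∂ⱼ g_{il} - ∂ₗ g_{ij})` of the Levi-Civita connection. -/
def christoffel (g : MetricField E M) (x₀ : M) (k i j : Fin (Module.finrank ℝ E)) (y : E) : ℝ :=
  (1 / 2 : ℝ) * ∑ l, (metricMatrix g x₀ y)⁻¹ k l *
    (partialDeriv i (fun z => metricMatrix g x₀ z j l) y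
      + partialDeriv j (fun z => metricMatrix g x₀ z i l) y
      - partialDeriv l (fun z => metricMatrix g x₀ z i j) y)

/-- The complex-valued Laplacian
`τ(φ) = trace_g ∇dφ = ∑ᵢⱼ gⁱʲ (∂ᵢ ∂ⱼ φ - ∑ₖ Γᵏᵢⱼ ∂ₖ φ)` at the point `x`. -/
def laplacian (g : MetricField E M) (φ : M → ℂ) (x : M) : ℂ :=
  let y : E := extChartAt 𝓘(ℝ, E) x x
  ∑ i, ∑ j, (((metricMatrix g x y)⁻¹ i j : ℝ) : ℂ) *
    (partialDeriv i (partialDeriv j (chartRep φ x)) y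
      - ∑ k, ((christoffel g x k i j y : ℝ) : ℂ) * partialDeriv k (chartRep φ x) y)

/-- The components `(grad φ)ⁱ = ∑ⱼ gⁱʲ ∂ⱼ φ` of the complex gradient at the point `x`. -/
def gradComponent (g : MetricField E M) (φ : M → ℂ) (x : M) (i : Fin (Module.finrank ℝ E)) : ℂ :=
  ∑ j, (((metricMatrix g x (extChartAt 𝓘(ℝ, E) x x))⁻¹ i j : ℝ) : ℂ) *
    partialDeriv j (chartRep φ x) (extChartAt 𝓘(ℝ, E) x x)

/-- The operator `κ(φ, ψ) = g(grad φ, grad ψ)`, with `g` extended complex bilinearly, at `x`. -/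
def kappa (g : MetricField E M) (φ ψ : M → ℂ) (x : M) : ℂ :=
  ∑ i, ∑ j, ((metricMatrix g x (extChartAt 𝓘(ℝ, E) x x) i j : ℝ) : ℂ) *
    gradComponent g φ x i * gradComponent g ψ x j

/-- The family `φ` of functions is an eigenfamily on the open set `W`, with eigenvalues `lam`, `mu`:
`τ(φᵢ) = lam φᵢ` and `κ(φᵢ, φⱼ) = mu φᵢ φⱼ` on `W`, for all `i`, `j`. -/
def IsEigenfamilyWith {A : Type*} (g : MetricField E M) (W : Set M) (φ : A → M → ℂ)
    (lam mu : ℂ) : Prop :=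
  (∀ i, ∀ x ∈ W, laplacian g (φ i) x = lam * φ i x) ∧
  (∀ i j, ∀ x ∈ W, kappa g (φ i) (φ j) x = mu * φ i x * φ j x)

/-- The family `φ` of functions is an eigenfamily on the open set `W`. -/
def IsEigenfamily {A : Type*} (g : MetricField E M) (W : Set M) (φ : A → M → ℂ) : Prop :=
  ∃ lam mu : ℂ, IsEigenfamilyWith g W φ lam mu

end SemiRiemannian

/-! ### Cartan decompositions -/

section Cartan

variable {L : Type*} [LieRing L] [LieAlgebra ℝ L]

/-- `L = k ⊕ p` is a Cartan decomposition of the real Lie algebra `L`. -/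
structure IsCartanDecomposition (k p : Submodule ℝ L) : Prop where
  isCompl : IsCompl k p
  lie_k_k : ∀ x ∈ k, ∀ y ∈ k, ⁅x, y⁆ ∈ k
  lie_k_p : ∀ x ∈ k, ∀ y ∈ p, ⁅x, y⁆ ∈ p
  lie_p_p : ∀ x ∈ p, ∀ y ∈ p, ⁅x, y⁆ ∈ k
  killing_neg : ∀ x ∈ k, x ≠ 0 → killingForm ℝ L x x < 0
  killing_pos : ∀ x ∈ p, x ≠ 0 → 0 < killingForm ℝ L x x

/-- A scalar product `B` on `V = k ⊕ p` which is negative definite on `k`, positive definite on `p`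
and for which `k` and `p` are orthogonal. -/
structure IsAdaptedScalarProduct {V : Type*} [AddCommGroup V] [Module ℝ V]
    (k p : Submodule ℝ V) (B : LinearMap.BilinForm ℝ V) : Prop where
  symm : ∀ x y, B x y = B y x
  orthogonal : ∀ x ∈ k, ∀ y ∈ p, B x y = 0
  neg : ∀ x ∈ k, x ≠ 0 → B x x < 0
  pos : ∀ x ∈ p, x ≠ 0 → 0 < B x x

end Cartan

/-! ### Lie groups, complexifications and compact duals -/

section LieGroups

variable {EG : Type*} [NormedAddCommGroup EG] [NormedSpace ℝ EG]
variable {G : Type*} [TopologicalSpace G] [ChartedSpace EG G] [Group G]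
variable {EU : Type*} [NormedAddCommGroup EU] [NormedSpace ℝ EU]
variable {U : Type*} [TopologicalSpace U] [ChartedSpace EU U] [Group U]
variable {EC : Type*} [NormedAddCommGroup EC] [NormedSpace ℂ EC]
variable {GC : Type*} [TopologicalSpace GC] [ChartedSpace EC GC] [Group GC]

/-- The differential at `x` of the left translation `y ↦ x⁻¹ y`, from the tangent space at `x` to the
Lie algebra (note that `x⁻¹ * x = 1`). -/
def leftTranslateToOne (x : G) :
    TangentSpace 𝓘(ℝ, EG) x →ₗ[ℝ] GroupLieAlgebra 𝓘(ℝ, EG) G :=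
  (mfderiv 𝓘(ℝ, EG) 𝓘(ℝ, EG) (fun y : G => x⁻¹ * y) x).toLinearMap

/-- The left-invariant metric on the Lie group `G` induced by a bilinear form on its Lie algebra. -/
def leftInvariantMetric (B : LinearMap.BilinForm ℝ (GroupLieAlgebra 𝓘(ℝ, EG) G)) :
    MetricField EG G :=
  fun x => B.compl₁₂ (leftTranslateToOne x) (leftTranslateToOne x)

/-- The real differential at the identity of a homomorphism into a complex Lie group `GC`, viewed as
a real manifold.  The tangent space of `GC` at `f 1 = 1` is its complex model space `EC`. -/
def differentialAtOne (f : G →* GC) : GroupLieAlgebra 𝓘(ℝ, EG) G →ₗ[ℝ] EC :=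
  (mfderiv 𝓘(ℝ, EG) 𝓘(ℝ, EC) f 1).toLinearMap

/-- The real linear map `(X, Y) ↦ dι(X) + i dι(Y)`. -/
def complexifiedDifferential (ι : G →* GC) :
    (GroupLieAlgebra 𝓘(ℝ, EG) G × GroupLieAlgebra 𝓘(ℝ, EG) G) →ₗ[ℝ] EC :=
  (differentialAtOne ι).coprod (Complex.I • differentialAtOne ι)

/-- `ι` exhibits the complex Lie group `GC` as a complexification of the real Lie group `G`: it is an
injective real-analytic homomorphism such that the Lie algebra of `GC` is the complexification
`dι(𝔤) ⊕ i dι(𝔤)` of the Lie algebra of `G` (in particular, `ι` is an immersion). -/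
structure IsComplexification (ι : G →* GC) : Prop where
  injective : Function.Injective ι
  contMDiff : ContMDiff 𝓘(ℝ, EG) 𝓘(ℝ, EC) ω ι
  bijective : Function.Bijective (complexifiedDifferential (EG := EG) (EC := EC) ι)

/-- `j` exhibits the (compact) Lie group `U` as the dual of `G` with respect to the decomposition
`𝔤 = k ⊕ p`: it is an injective real-analytic immersive homomorphism into the complexification and
identifies the Lie algebra of `U` with `dι(k) ⊕ i dι(p)`. -/
structure IsCompactDual (ι : G →* GC) (k p : Submodule ℝ (GroupLieAlgebra 𝓘(ℝ, EG) G))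
    (j : U →* GC) : Prop where
  injective : Function.Injective j
  contMDiff : ContMDiff 𝓘(ℝ, EU) 𝓘(ℝ, EC) ω j
  immersion : Function.Injective (differentialAtOne (EG := EU) (EC := EC) j)
  range_eq : ∀ z : EC, (∃ u, differentialAtOne (EG := EU) (EC := EC) j u = z) ↔
    ∃ y ∈ k, ∃ x ∈ p, z = differentialAtOne ι y + Complex.I • differentialAtOne ι x

/-- The scalar product on the Lie algebra of `U` which is dual to the scalar product `B` on the Lie
algebra of `G`, namely `-Re B^ℂ`, where `B^ℂ` is the complex bilinear extension of `B` to the Lie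
algebra of `GC`: if `dj(u) = dι(a) + i dι(b)` and `dj(v) = dι(a') + i dι(b')` then the value at
`(u, v)` is `-B(a, a') + B(b, b')`. -/
def dualForm {ι : G →* GC} (hι : IsComplexification (EG := EG) (EC := EC) ι) (j : U →* GC)
    (B : LinearMap.BilinForm ℝ (GroupLieAlgebra 𝓘(ℝ, EG) G)) :
    LinearMap.BilinForm ℝ (GroupLieAlgebra 𝓘(ℝ, EU) U) :=
  let e := (LinearEquiv.ofBijective (complexifiedDifferential ι) hι.bijective).symm
  let re := (LinearMap.fst ℝ _ _ ∘ₗ e.toLinearMap) ∘ₗ differentialAtOne (EC := EC) j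
  let im := (LinearMap.snd ℝ _ _ ∘ₗ e.toLinearMap) ∘ₗ differentialAtOne (EC := EC) j
  B.compl₁₂ im im - B.compl₁₂ re re

/-- `φC` is a holomorphic function on `WC` which extends `φ : W → ℂ`. -/
structure IsHolomorphicExtension (ι : G →* GC) (W : Set G) (φ : G → ℂ) (WC : Set GC)
    (φC : GC → ℂ) : Prop where
  image_subset : ι '' W ⊆ WC
  holomorphic : ContMDiffOn 𝓘(ℂ, EC) 𝓘(ℂ, ℂ) ω φC WC
  extends_eq : ∀ x ∈ W, φC (ι x) = φ x

end LieGroups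

end

/-! A left-invariant metric has constant coefficients in a left-invariant frame, so its operators
depend only on the scalar product and the Lie bracket: κ(φ,ψ) = ∑ gⁱʲ Xᵢφ Xⱼψ and τ(φ) = ∑ gⁱʲ
(XᵢXⱼφ − tr(ad Xᵢ) Xⱼφ) (`kappa_leftInvariantMetric`, `laplacian_leftInvariantMetric`). Both are
metric traces of bilinear maps, and they make sense over ℂ on the complex group, with Bᶜ and
left-invariant holomorphic derivatives (`leftDerivProduct`, `leftHessian`).

A real basis of either real form 𝔤 or 𝔲 is a complex basis of 𝔤ᶜ, and the trace does not depend on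
the basis. Hence the same two holomorphic operators induce τ and κ on both groups, up to a sign s:
Bᶜ restricts to B on 𝔤 (s = 1) and to minus the dual product on 𝔲 (s = −1). This is
`laplacian_eq_metricTrace` and `kappa_eq_metricTrace`, and it is the origin of the eigenvalues −λ,
−μ.

It remains to move the equations between a real form and Wᶜ. Restriction is immediate. Conversely, a
holomorphic function vanishing on an open piece of a real form has zero derivatives along the real
form, hence by complex linearity along all left-invariant directions; iterating, it vanishes to
infinite order, hence on every component that meets the piece (`eq_zero_of_comp_hom_eq_zero`). -/

noncomputable section

/-! ### Metric traces and contracted Christoffel symbols -/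

/-- The trace of a bilinear map `T` with respect to a bilinear form `β`, computed in the basis `b`. -/
def metricTrace {K V W ι : Type*} [Field K] [AddCommGroup V] [Module K V] [AddCommGroup W]
    [Module K W] [Fintype ι] [DecidableEq ι] (b : Module.Basis ι K V)
    (β : LinearMap.BilinForm K V) (T : V →ₗ[K] V →ₗ[K] W) : W :=
  ∑ i, ∑ j, (LinearMap.BilinForm.toMatrix b β)⁻¹ i j • T (b i) (b j)

/-- The inverse Gram matrix transforms contragrediently to the entries of `T`. This allows one fixed
complex basis to be compared with the point-dependent bases coming from charts of the two real
forms. -/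
theorem metricTrace_basis_independent {K V W ι κ : Type*} [Field K] [AddCommGroup V] [Module K V]
    [AddCommGroup W] [Module K W] [Fintype ι] [DecidableEq ι] [Fintype κ] [DecidableEq κ]
    (b : Module.Basis ι K V) (c : Module.Basis κ K V)
    (β : LinearMap.BilinForm K V) (T : V →ₗ[K] V →ₗ[K] W)
    (hb : IsUnit (LinearMap.BilinForm.toMatrix b β)) :
    metricTrace b β T = metricTrace c β T := by
  have hinv : (LinearMap.BilinForm.toMatrix c β)⁻¹
      = c.toMatrix b * (LinearMap.BilinForm.toMatrix b β)⁻¹ * (c.toMatrix b).transpose := by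
    apply Matrix.inv_eq_left_inv
    rw [← LinearMap.BilinForm.toMatrix_mul_basis_toMatrix b c β]
    have h1 : (c.toMatrix b).transpose * (b.toMatrix c).transpose = 1 := by
      rw [← Matrix.transpose_mul, Module.Basis.toMatrix_mul_toMatrix_flip, Matrix.transpose_one]
    have h2 : (LinearMap.BilinForm.toMatrix b β)⁻¹ * LinearMap.BilinForm.toMatrix b β = 1 :=
      Matrix.nonsing_inv_mul _ ((Matrix.isUnit_iff_isUnit_det _).1 hb)
    calc _ = c.toMatrix b * (LinearMap.BilinForm.toMatrix b β)⁻¹ *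
          ((c.toMatrix b).transpose * (b.toMatrix c).transpose) *
            LinearMap.BilinForm.toMatrix b β * b.toMatrix c := by
          simp only [Matrix.mul_assoc]
      _ = 1 := by
          rw [h1, Matrix.mul_one, Matrix.mul_assoc (c.toMatrix b), h2, Matrix.mul_one,
            Module.Basis.toMatrix_mul_toMatrix_flip]
  have hbc : ∀ i, b i = ∑ k, c.toMatrix b k i • c k := fun i =>
    (c.sum_toMatrix_smul_self b i).symm
  unfold metricTrace
  rw [hinv]
  have hT : ∀ i j, T (b i) (b j)
      = ∑ k, ∑ l, (c.toMatrix b k i * c.toMatrix b l j) • T (c k) (c l) := by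
    intro i j
    rw [hbc i, hbc j]
    simp only [map_sum, map_smul, LinearMap.sum_apply, LinearMap.smul_apply, Finset.smul_sum,
      smul_smul]
    rw [Finset.sum_comm]
    exact Finset.sum_congr rfl fun k _ => Finset.sum_congr rfl fun l _ => by rw [mul_comm]
  simp only [hT, Finset.smul_sum, smul_smul, Matrix.mul_apply, Matrix.transpose_apply,
    Finset.sum_mul, Finset.sum_smul]
  rw [Finset.sum_comm_cycle]
  refine Finset.sum_congr rfl fun k _ => ?_
  rw [Finset.sum_comm_cycle]
  refine Finset.sum_congr rfl fun l _ => ?_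
  rw [Finset.sum_comm]
  refine Finset.sum_congr rfl fun j _ => Finset.sum_congr rfl fun i _ => ?_
  congr 1
  ring

/-- The contracted Christoffel symbols of a metric with Gram matrix `M`, whose derivatives `d` are
those of a metric which is constant in a moving frame with connection coefficients `a`. -/
theorem sum_inv_mul_christoffel {ι : Type*} [Fintype ι] [DecidableEq ι]
    (M : Matrix ι ι ℝ) (hM : IsUnit M) (hs : M.transpose = M) (a : ι → ι → ι → ℝ)
    (α : ι → ι → ι → ℝ) (hα : ∀ i j l, α i j l = ∑ k, a i j k * M k l)
    (d : ι → ι → ι → ℝ) (hd : ∀ i j l, d i j l = -α i j l - α i l j) (k : ι) :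
    ∑ i, ∑ j, M⁻¹ i j * ((1 / 2 : ℝ) * ∑ l, M⁻¹ k l * (d i j l + d j i l - d l i j))
      = -∑ i, ∑ j, M⁻¹ i j * a i j k + ∑ l, M⁻¹ k l * ∑ i, (a l i i - a i l i) := by
  have hdet := (Matrix.isUnit_iff_isUnit_det _).1 hM
  have hsi : ∀ i j, M⁻¹ i j = M⁻¹ j i := by
    intro i j
    have : M⁻¹.transpose = M⁻¹ := by rw [Matrix.transpose_nonsing_inv, hs]
    exact (congrFun (congrFun this i) j).symm
  have hMM : ∀ i j, ∑ k, M i k * M⁻¹ k j = if i = j then 1 else 0 := by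
    intro i j
    have := congrFun (congrFun (Matrix.mul_nonsing_inv M hdet) i) j
    rwa [Matrix.mul_apply, Matrix.one_apply] at this
  have h1 : ∀ i j k, ∑ l, M⁻¹ k l * α i j l = a i j k := by
    intro i j k
    simp only [hα, Finset.mul_sum]
    rw [Finset.sum_comm]
    calc ∑ m, ∑ l, M⁻¹ k l * (a i j m * M m l)
        = ∑ m, a i j m * ∑ l, M m l * M⁻¹ l k := by
          refine Finset.sum_congr rfl fun m _ => ?_
          rw [Finset.mul_sum]
          refine Finset.sum_congr rfl fun l _ => ?_
          rw [hsi k l]; ring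
      _ = a i j k := by simp [hMM]
  have h2 : ∀ l, ∑ i, ∑ j, M⁻¹ i j * α l i j = ∑ i, a l i i := fun l =>
    Finset.sum_congr rfl fun i _ => h1 l i i
  have h3 : ∀ l, ∑ i, ∑ j, M⁻¹ i j * α i l j = ∑ i, a i l i := fun l =>
    Finset.sum_congr rfl fun i _ => h1 i l i
  have swap : ∀ f : ι → ι → ℝ, ∑ i, ∑ j, M⁻¹ i j * f j i = ∑ i, ∑ j, M⁻¹ i j * f i j := by
    intro f
    rw [Finset.sum_comm]
    exact Finset.sum_congr rfl fun i _ => Finset.sum_congr rfl fun j _ => by rw [hsi]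
  -- Contraction with the symmetric `M⁻¹` makes i and j interchangeable, so the six terms collapse
  -- to −2αᵢⱼₗ − 2αᵢₗⱼ + 2αₗᵢⱼ; the last two contract to traces of `a`.
  have key : ∀ l, ∑ i, ∑ j, M⁻¹ i j * (d i j l + d j i l - d l i j)
      = -2 * ∑ i, ∑ j, M⁻¹ i j * α i j l + 2 * ∑ i, (a l i i - a i l i) := by
    intro l
    have e1 := swap fun i j => α i j l
    have e2 := swap fun i j => α i l j
    have e3 := swap fun i j => α l i j
    simp only [Finset.sum_sub_distrib, ← h2, ← h3]
    simp only [hd]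
    simp only [mul_add, mul_sub, mul_neg, Finset.sum_add_distrib, Finset.sum_sub_distrib,
      Finset.sum_neg_distrib] at *
    linarith
  calc _ = (1 / 2 : ℝ) * ∑ l, M⁻¹ k l * ∑ i, ∑ j, M⁻¹ i j * (d i j l + d j i l - d l i j) := by
        simp only [Finset.mul_sum]
        refine Finset.sum_comm_cycle.trans ?_
        refine Finset.sum_congr rfl fun l _ => Finset.sum_congr rfl fun i _ =>
          Finset.sum_congr rfl fun j _ => ?_
        ring
    _ = _ := by
        simp only [key]
        simp only [mul_add, Finset.sum_add_distrib]
        have : ∑ l, M⁻¹ k l * (-2 * ∑ i, ∑ j, M⁻¹ i j * α i j l)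
            = -2 * ∑ i, ∑ j, M⁻¹ i j * a i j k := by
          simp only [← h1, Finset.mul_sum]
          refine Eq.trans ?_ Finset.sum_comm_cycle.symm
          refine Finset.sum_congr rfl fun l _ => Finset.sum_congr rfl fun i _ =>
            Finset.sum_congr rfl fun j _ => ?_
          ring
        rw [this]
        have : ∑ l, M⁻¹ k l * (2 * ∑ i, (a l i i - a i l i))
            = 2 * ∑ l, M⁻¹ k l * ∑ i, (a l i i - a i l i) := by
          rw [Finset.mul_sum]
          exact Finset.sum_congr rfl fun i _ => by ring
        rw [this]
        ring

/-! ### Left-invariant derivatives and frames in charts -/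

section ChartRegularity

variable {𝕜 : Type*} [RCLike 𝕜] {E : Type*} [NormedAddCommGroup E] [NormedSpace 𝕜 E]
variable {H : Type*} [TopologicalSpace H] [ChartedSpace E H] [IsManifold 𝓘(𝕜, E) ω H]
variable {F : Type*} [NormedAddCommGroup F] [NormedSpace 𝕜 F]

theorem contMDiffAt_chartAt_symm_of_mem (x₀ : H) {y : E} (hy : y ∈ (chartAt E x₀).target) :
    ContMDiffAt 𝓘(𝕜, E) 𝓘(𝕜, E) ω (chartAt E x₀).symm y :=
  (contMDiffOn_chart_symm (I := 𝓘(𝕜, E)) (n := ω) (x := x₀)).contMDiffAt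
    ((chartAt E x₀).open_target.mem_nhds hy)

theorem contMDiffAt_chartAt_of_mem (x₀ : H) {x : H} (hx : x ∈ (chartAt E x₀).source) :
    ContMDiffAt 𝓘(𝕜, E) 𝓘(𝕜, E) ω (chartAt E x₀) x :=
  (contMDiffOn_chart (I := 𝓘(𝕜, E)) (n := ω) (x := x₀)).contMDiffAt
    ((chartAt E x₀).open_source.mem_nhds hx)

theorem contDiffAt_comp_chart_symm {f : H → F} {x₀ : H} {y : E}
    (hy : y ∈ (chartAt E x₀).target)
    (hf : ContMDiffAt 𝓘(𝕜, E) 𝓘(𝕜, F) ω f ((chartAt E x₀).symm y)) :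
    ContDiffAt 𝕜 ω (f ∘ (chartAt E x₀).symm) y :=
  contMDiffAt_iff_contDiffAt.1 (ContMDiffAt.comp y hf (contMDiffAt_chartAt_symm_of_mem x₀ hy))

end ChartRegularity

section LeftDeriv

variable (𝕜 : Type*) [RCLike 𝕜] (E : Type*) [NormedAddCommGroup E] [NormedSpace 𝕜 E]
variable {H : Type*} [TopologicalSpace H] [ChartedSpace E H] [Group H]
variable {F : Type*} [NormedAddCommGroup F] [NormedSpace 𝕜 F]

/-- The derivative of `f` at `x` along left-invariant vector fields, as a function of their value
at the identity, read in the preferred chart there. -/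
def leftDeriv (f : H → F) (x : H) : E →L[𝕜] F :=
  fderiv 𝕜 (fun u => f (x * (chartAt E (1 : H)).symm u)) (chartAt E (1 : H) 1)

/-- The left-invariant frame read in the preferred chart at `x₀`. -/
def leftFrame (x₀ : H) (y : E) : E →L[𝕜] E :=
  leftDeriv 𝕜 E (chartAt E x₀) ((chartAt E x₀).symm y)

/-- The Maurer-Cartan form read in the preferred chart at `x₀`. -/
def leftCoframe (x₀ : H) (y : E) : E →L[𝕜] E :=
  fderiv 𝕜 (fun u => chartAt E (1 : H) (((chartAt E x₀).symm y)⁻¹ * (chartAt E x₀).symm u)) y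

variable {𝕜 E}

theorem leftDeriv_mul_left (f : H → F) (g x : H) :
    leftDeriv 𝕜 E (fun z => f (g * z)) x = leftDeriv 𝕜 E f (g * x) := by
  simp only [leftDeriv, mul_assoc]

theorem leftDeriv_congr {f g : H → F} {x : H} [ContinuousMul H] (h : f =ᶠ[nhds x] g) :
    leftDeriv 𝕜 E f x = leftDeriv 𝕜 E g x := by
  unfold leftDeriv
  apply Filter.EventuallyEq.fderiv_eq
  have hc : Filter.Tendsto (fun u => x * (chartAt E (1 : H)).symm u) (nhds (chartAt E (1 : H) 1))
      (nhds x) := by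
    have := (chartAt E (1 : H)).continuousAt_symm (mem_chart_target E (1 : H))
    have h2 : ContinuousAt (fun u => x * (chartAt E (1 : H)).symm u) (chartAt E (1 : H) 1) :=
      continuousAt_const.mul this
    simpa [ContinuousAt] using h2
  exact hc.eventually h

theorem leftDeriv_chart_one :
    leftDeriv 𝕜 E (chartAt E (1 : H)) (1 : H) = ContinuousLinearMap.id 𝕜 E := by
  refine HasFDerivAt.fderiv ((hasFDerivAt_id _).congr_of_eventuallyEq ?_)
  filter_upwards [(chartAt E (1 : H)).open_target.mem_nhds (mem_chart_target E (1 : H))] with u hu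
  simp [(chartAt E (1 : H)).right_inv hu]

variable [LieGroup 𝓘(𝕜, E) ω H]

theorem contDiffAt_comp_mul_left_chart_symm {f : H → F} {x g : H} {y : E}
    {x₀ : H} (hy : y ∈ (chartAt E x₀).target) (hx : g * (chartAt E x₀).symm y = x)
    (hf : ContMDiffAt 𝓘(𝕜, E) 𝓘(𝕜, F) ω f x) :
    ContDiffAt 𝕜 ω (fun u => f (g * (chartAt E x₀).symm u)) y := by
  rw [← contMDiffAt_iff_contDiffAt]
  subst hx
  have h1 := contMDiffAt_chartAt_symm_of_mem (𝕜 := 𝕜) x₀ hy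
  have h2 : ContMDiffAt 𝓘(𝕜, E) 𝓘(𝕜, E) ω (fun u => g * (chartAt E x₀).symm u) y :=
    ContMDiffAt.mul contMDiffAt_const h1
  exact ContMDiffAt.comp y hf h2

/-- The derivative in u of the analytic map (z, u) ↦ f(z · u) depends analytically on the parameter
z, and no regularity is lost at order ω, so left derivatives can be iterated. -/
theorem contMDiffAt_leftDeriv {f : H → F} {x : H} (hf : ContMDiffAt 𝓘(𝕜, E) 𝓘(𝕜, F) ω f x) :
    ContMDiffAt 𝓘(𝕜, E) 𝓘(𝕜, E →L[𝕜] F) ω (leftDeriv 𝕜 E f) x := by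
  have h1 := contMDiffAt_chartAt_symm_of_mem (𝕜 := 𝕜) (1 : H) (mem_chart_target E (1 : H))
  have h2 : ContMDiffAt (𝓘(𝕜, E).prod 𝓘(𝕜, E)) 𝓘(𝕜, E) ω
      (fun q : H × E => q.1 * (chartAt E (1 : H)).symm q.2) (x, chartAt E (1 : H) 1) :=
    ContMDiffAt.mul contMDiffAt_fst (ContMDiffAt.comp _ h1 contMDiffAt_snd)
  have h3 : ContMDiffAt (𝓘(𝕜, E).prod 𝓘(𝕜, E)) 𝓘(𝕜, F) ω
      (Function.uncurry fun (z : H) (u : E) => f (z * (chartAt E (1 : H)).symm u))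
      (x, chartAt E (1 : H) 1) := by
    refine ContMDiffAt.comp (x, chartAt E (1 : H) 1) (g := f) ?_ h2
    simpa using hf
  have : IsManifold 𝓘(𝕜, E) 1 H := IsManifold.of_le (n := ω) le_top
  have h4 := ContMDiffAt.mfderiv (m := ω) _ (fun _ : H => chartAt E (1 : H) 1) h3
    contMDiffAt_const le_top
  simp only [inTangentCoordinates_model_space, mfderiv_eq_fderiv] at h4
  exact h4

theorem hasFDerivAt_leftDeriv {f : H → F} {x : H} (hf : ContMDiffAt 𝓘(𝕜, E) 𝓘(𝕜, F) ω f x) :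
    HasFDerivAt (fun u => f (x * (chartAt E (1 : H)).symm u)) (leftDeriv 𝕜 E f x)
      (chartAt E (1 : H) 1) :=
  ((contDiffAt_comp_mul_left_chart_symm (mem_chart_target E (1 : H)) (by simp) hf).differentiableAt
    (by simp)).hasFDerivAt

/-- Chain rule for f = (f ∘ chart⁻¹) ∘ chart, an identity valid only near the point. -/
theorem leftDeriv_eq_fderiv_comp_leftFrame {f : H → F} {x₀ : H} {y : E}
    (hy : y ∈ (chartAt E x₀).target)
    (hf : ContMDiffAt 𝓘(𝕜, E) 𝓘(𝕜, F) ω f ((chartAt E x₀).symm y)) :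
    leftDeriv 𝕜 E f ((chartAt E x₀).symm y)
      = (fderiv 𝕜 (f ∘ (chartAt E x₀).symm) y).comp (leftFrame 𝕜 E x₀ y) := by
  have : ContinuousMul H := continuousMul_of_contMDiffMul 𝓘(𝕜, E) ω
  have hs := (chartAt E x₀).map_target hy
  have h1 := hasFDerivAt_leftDeriv (contMDiffAt_chartAt_of_mem (𝕜 := 𝕜) x₀ hs)
  have h2 := ((contDiffAt_comp_chart_symm hy hf).differentiableAt (by simp)).hasFDerivAt
  have hc : leftDeriv 𝕜 E f ((chartAt E x₀).symm y)
      = leftDeriv 𝕜 E ((f ∘ (chartAt E x₀).symm) ∘ chartAt E x₀) ((chartAt E x₀).symm y) := by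
    apply leftDeriv_congr
    filter_upwards [(chartAt E x₀).open_source.mem_nhds hs] with z hz
    simp [(chartAt E x₀).left_inv hz]
  rw [hc]
  refine HasFDerivAt.fderiv ?_
  refine HasFDerivAt.comp (chartAt E (1 : H) 1) (g := f ∘ (chartAt E x₀).symm) ?_ h1
  simpa [(chartAt E x₀).right_inv hy] using h2

/-- The chain rule is applied to z ↦ chart₁(x⁻¹z): by left invariance its left derivative at x is
that of the chart at 1, which is the identity. -/
theorem leftCoframe_comp_leftFrame {x₀ : H} {y : E} (hy : y ∈ (chartAt E x₀).target) :
    (leftCoframe 𝕜 E x₀ y).comp (leftFrame 𝕜 E x₀ y) = ContinuousLinearMap.id 𝕜 E := by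
  set x := (chartAt E x₀).symm y with hx
  have h0 := contMDiffAt_chartAt_of_mem (𝕜 := 𝕜) (1 : H) (mem_chart_source E (1 : H))
  have h1 : ContMDiffAt 𝓘(𝕜, E) 𝓘(𝕜, E) ω (fun z => chartAt E (1 : H) (x⁻¹ * z)) x := by
    refine ContMDiffAt.comp x (g := chartAt E (1 : H)) (by simpa using h0) ?_
    exact ContMDiffAt.mul contMDiffAt_const contMDiffAt_id
  have h2 := leftDeriv_eq_fderiv_comp_leftFrame hy h1
  rw [leftDeriv_mul_left (fun z => chartAt E (1 : H) z)] at h2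
  refine h2.symm.trans ?_
  rw [← hx, inv_mul_cancel]
  refine HasFDerivAt.fderiv ((hasFDerivAt_id _).congr_of_eventuallyEq ?_)
  filter_upwards [(chartAt E (1 : H)).open_target.mem_nhds (mem_chart_target E (1 : H))] with u hu
  simp [(chartAt E (1 : H)).right_inv hu]

theorem contDiffAt_leftFrame {x₀ : H} {y : E} (hy : y ∈ (chartAt E x₀).target) :
    ContDiffAt 𝕜 ω (leftFrame 𝕜 E x₀) y :=
  contDiffAt_comp_chart_symm hy
    (contMDiffAt_leftDeriv (contMDiffAt_chartAt_of_mem x₀ ((chartAt E x₀).map_target hy)))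

section FiniteDimensional

variable [FiniteDimensional 𝕜 E]

theorem leftFrame_comp_leftCoframe {x₀ : H} {y : E} (hy : y ∈ (chartAt E x₀).target) :
    (leftFrame 𝕜 E x₀ y).comp (leftCoframe 𝕜 E x₀ y) = ContinuousLinearMap.id 𝕜 E := by
  have h := congrArg (fun l : E →L[𝕜] E => (l : E →ₗ[𝕜] E)) (leftCoframe_comp_leftFrame (𝕜 := 𝕜) hy)
  have h2 : (leftFrame 𝕜 E x₀ y : E →ₗ[𝕜] E) ∘ₗ (leftCoframe 𝕜 E x₀ y : E →ₗ[𝕜] E) = LinearMap.id :=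
    mul_eq_one_comm.1 h
  ext v
  exact congrArg (fun l : E →ₗ[𝕜] E => l v) h2

/-- In finite dimension the coframe is the two-sided inverse of the frame, and inversion of
operators is analytic. -/
theorem contDiffAt_leftCoframe {x₀ : H} {y : E} (hy : y ∈ (chartAt E x₀).target) :
    ContDiffAt 𝕜 ω (leftCoframe 𝕜 E x₀) y := by
  have : CompleteSpace E := FiniteDimensional.complete 𝕜 E
  have h : ∀ z ∈ (chartAt E x₀).target,
      leftCoframe 𝕜 E x₀ z = ContinuousLinearMap.inverse (leftFrame 𝕜 E x₀ z) := fun z hz =>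
    (ContinuousLinearMap.inverse_eq (leftFrame_comp_leftCoframe hz)
      (leftCoframe_comp_leftFrame hz)).symm
  have h1 : ContDiffAt 𝕜 ω (fun z => ContinuousLinearMap.inverse (leftFrame 𝕜 E x₀ z)) y := by
    let e : E ≃L[𝕜] E := ContinuousLinearEquiv.equivOfInverse' (leftFrame 𝕜 E x₀ y)
      (leftCoframe 𝕜 E x₀ y) (leftFrame_comp_leftCoframe hy) (leftCoframe_comp_leftFrame hy)
    exact ContDiffAt.comp y (contDiffAt_map_inverse e) (contDiffAt_leftFrame hy)
  refine h1.congr_of_eventuallyEq ?_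
  filter_upwards [(chartAt E x₀).open_target.mem_nhds hy] with z hz using h z hz

end FiniteDimensional

/-- Product rule applied to y ↦ D(f ∘ chart⁻¹)(y)(V(y)Y), with V the frame; the second summand
records that V is not constant in the chart. -/
theorem leftDeriv_leftDeriv {f : H → F} {x₀ : H}
    (hf : ContMDiffAt 𝓘(𝕜, E) 𝓘(𝕜, F) ω f x₀) (X Y : E) :
    leftDeriv 𝕜 E (fun z => leftDeriv 𝕜 E f z Y) x₀ X
      = fderiv 𝕜 (fderiv 𝕜 (f ∘ (chartAt E x₀).symm)) (chartAt E x₀ x₀)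
            (leftFrame 𝕜 E x₀ (chartAt E x₀ x₀) X) (leftFrame 𝕜 E x₀ (chartAt E x₀ x₀) Y)
        + fderiv 𝕜 (f ∘ (chartAt E x₀).symm) (chartAt E x₀ x₀)
            (fderiv 𝕜 (leftFrame 𝕜 E x₀) (chartAt E x₀ x₀)
              (leftFrame 𝕜 E x₀ (chartAt E x₀ x₀) X) Y) := by
  have hy := mem_chart_target E x₀
  have hx : (chartAt E x₀).symm (chartAt E x₀ x₀) = x₀ :=
    (chartAt E x₀).left_inv (mem_chart_source E x₀)
  set y := chartAt E x₀ x₀ with hy'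
  have hg : ContMDiffAt 𝓘(𝕜, E) 𝓘(𝕜, F) ω (fun z => leftDeriv 𝕜 E f z Y)
      ((chartAt E x₀).symm y) := by
    rw [hx]
    exact (contMDiffAt_leftDeriv hf).clm_apply contMDiffAt_const
  have h1 := leftDeriv_eq_fderiv_comp_leftFrame hy hg
  have hfx : ContMDiffAt 𝓘(𝕜, E) 𝓘(𝕜, F) ω f ((chartAt E x₀).symm y) := by rwa [hx]
  have hΦ := contDiffAt_comp_chart_symm hy hfx
  have h2 : ((fun z => leftDeriv 𝕜 E f z Y) ∘ (chartAt E x₀).symm) =ᶠ[nhds y]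
      fun z => fderiv 𝕜 (f ∘ (chartAt E x₀).symm) z (leftFrame 𝕜 E x₀ z Y) := by
    have hc : ContinuousAt (chartAt E x₀).symm y := (chartAt E x₀).continuousAt_symm hy
    have : IsManifold 𝓘(𝕜, E) 1 H := IsManifold.of_le (n := ω) le_top
    have hev : ∀ᶠ z in nhds y, ContMDiffAt 𝓘(𝕜, E) 𝓘(𝕜, F) ω f ((chartAt E x₀).symm z) :=
      hc.eventually ((contMDiffAt_iff_contMDiffAt_nhds (by simp)).1 hfx)
    filter_upwards [hev, (chartAt E x₀).open_target.mem_nhds hy] with z hz hzt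
    simp [leftDeriv_eq_fderiv_comp_leftFrame hzt hz]
  have h3 : HasFDerivAt (fderiv 𝕜 (f ∘ (chartAt E x₀).symm))
      (fderiv 𝕜 (fderiv 𝕜 (f ∘ (chartAt E x₀).symm)) y) y :=
    ((hΦ.fderiv_right (m := ω) le_top).differentiableAt (by simp)).hasFDerivAt
  have h4 : HasFDerivAt (leftFrame 𝕜 E x₀) (fderiv 𝕜 (leftFrame 𝕜 E x₀) y) y :=
    ((contDiffAt_leftFrame hy).differentiableAt (by simp)).hasFDerivAt
  have h5 := h3.clm_apply (h4.clm_apply (hasFDerivAt_const Y y))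
  rw [h2.fderiv_eq, h5.fderiv, hx] at h1
  rw [h1]
  simp [add_comm]

end LeftDeriv

/-! ### The Laplacian and κ of a left-invariant metric -/

/-- The part −a of the contracted Christoffel symbols turns the chart Hessian `D` into iterated
left-invariant derivatives. What is left over is the trace term `t`. -/
theorem sum_inv_mul_hessian_sub_christoffel {ι : Type*} [Fintype ι] (N : ι → ι → ℝ)
    (hN : ∀ i j, N i j = N j i) (Γ : ι → ι → ι → ℝ) (a : ι → ι → ι → ℝ) (t : ι → ℝ)
    (hΓ : ∀ k, ∑ i, ∑ j, N i j * Γ k i j = -∑ i, ∑ j, N i j * a i j k + ∑ l, N k l * t l)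
    (D : ι → ι → ℂ) (q : ι → ℂ) :
    ∑ i, ∑ j, (N i j : ℂ) * (D i j - ∑ k, (Γ k i j : ℂ) * q k)
      = ∑ i, ∑ j, (N i j : ℂ) * (D i j + ∑ k, (a i j k : ℂ) * q k - t i * q j) := by
  have h1 : ∑ k, (∑ i, ∑ j, (N i j : ℂ) * (Γ k i j : ℂ)) * q k
      = ∑ k, (-∑ i, ∑ j, (N i j : ℂ) * (a i j k : ℂ) + ∑ l, (N k l : ℂ) * (t l : ℂ)) * q k := by
    refine Finset.sum_congr rfl fun k _ => ?_
    congr 1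
    exact_mod_cast hΓ k
  have h2 : ∀ f : ι → ι → ι → ℝ, ∑ k, (∑ i, ∑ j, (N i j : ℂ) * (f k i j : ℂ)) * q k
      = ∑ i, ∑ j, (N i j : ℂ) * ∑ k, (f k i j : ℂ) * q k := by
    intro f
    simp only [Finset.sum_mul, Finset.mul_sum]
    refine Eq.trans ?_ Finset.sum_comm_cycle.symm
    refine Finset.sum_congr rfl fun l _ => Finset.sum_congr rfl fun i _ =>
      Finset.sum_congr rfl fun j _ => ?_
    ring
  have h3 : ∑ k, (∑ l, (N k l : ℂ) * (t l : ℂ)) * q k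
      = ∑ i, ∑ j, (N i j : ℂ) * (t i * q j) := by
    simp only [Finset.sum_mul]
    rw [Finset.sum_comm]
    refine Finset.sum_congr rfl fun i _ => Finset.sum_congr rfl fun j _ => ?_
    rw [hN i j]
    ring
  simp only [add_mul, neg_mul, Finset.sum_add_distrib, Finset.sum_neg_distrib] at h1
  rw [h2, h2 fun k i j => a i j k, h3] at h1
  simp only [mul_add, mul_sub, Finset.sum_add_distrib, Finset.sum_sub_distrib]
  rw [h1]
  ring

theorem sum_mul_inv_mul_inv {ι : Type*} [Fintype ι] [DecidableEq ι] (M : Matrix ι ι ℝ)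
    (hM : IsUnit M) (hs : M.transpose = M) (q r : ι → ℂ) :
    ∑ i, ∑ j, (M i j : ℂ) * (∑ k, (M⁻¹ i k : ℂ) * q k) * (∑ l, (M⁻¹ j l : ℂ) * r l)
      = ∑ i, ∑ j, (M⁻¹ i j : ℂ) * (q i * r j) := by
  have hdet := (Matrix.isUnit_iff_isUnit_det _).1 hM
  have hsi : ∀ i j, M⁻¹ i j = M⁻¹ j i := by
    intro i j
    have : M⁻¹.transpose = M⁻¹ := by rw [Matrix.transpose_nonsing_inv, hs]
    exact (congrFun (congrFun this i) j).symm
  have hMM : ∀ i l, ∑ j, (M i j : ℂ) * (M⁻¹ j l : ℂ) = if i = l then 1 else 0 := by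
    intro i j
    have := congrFun (congrFun (Matrix.mul_nonsing_inv M hdet) i) j
    rw [Matrix.mul_apply, Matrix.one_apply] at this
    have h := congrArg (fun s : ℝ => (s : ℂ)) this
    push_cast at h
    rw [h]
    split_ifs <;> simp
  have h1 : ∀ i, ∑ j, (M i j : ℂ) * (∑ l, (M⁻¹ j l : ℂ) * r l) = r i := by
    intro i
    simp only [Finset.mul_sum]
    rw [Finset.sum_comm]
    simp only [← mul_assoc, ← Finset.sum_mul, hMM]
    simp
  calc _ = ∑ i, (∑ k, (M⁻¹ i k : ℂ) * q k) * ∑ j, (M i j : ℂ) * (∑ l, (M⁻¹ j l : ℂ) * r l) := by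
        refine Finset.sum_congr rfl fun i _ => ?_
        rw [Finset.mul_sum]
        exact Finset.sum_congr rfl fun j _ => by ring
    _ = _ := by
        simp only [h1, Finset.sum_mul]
        rw [Finset.sum_comm]
        refine Finset.sum_congr rfl fun i _ => Finset.sum_congr rfl fun j _ => ?_
        rw [hsi i j]
        ring

section Frame

variable (𝕜 : Type*) [RCLike 𝕜] {E : Type*} [NormedAddCommGroup E] [NormedSpace 𝕜 E]
variable {H : Type*} [TopologicalSpace H] [ChartedSpace E H] [Group H]

/-- The flat derivative `D_{V X} (V Y)` of the left-invariant frame `V` in the preferred chart at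
`x₀`, expressed in the frame. -/
def frameConnection (x₀ : H) : E →ₗ[𝕜] E →ₗ[𝕜] E :=
  LinearMap.mk₂ 𝕜 (fun X Y => leftCoframe 𝕜 E x₀ (chartAt E x₀ x₀)
    (fderiv 𝕜 (leftFrame 𝕜 E x₀) (chartAt E x₀ x₀) (leftFrame 𝕜 E x₀ (chartAt E x₀ x₀) X) Y))
    (by simp) (by simp) (by simp) (by simp)

/-- The structure constants of the left-invariant frame. -/
def frameBracket (x₀ : H) : E →ₗ[𝕜] E →ₗ[𝕜] E :=
  frameConnection 𝕜 x₀ - (frameConnection 𝕜 x₀).flip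

end Frame

section Metric

variable {E : Type*} [NormedAddCommGroup E] [NormedSpace ℝ E] [FiniteDimensional ℝ E]
variable {H : Type*} [TopologicalSpace H] [ChartedSpace E H] [Group H] [LieGroup 𝓘(ℝ, E) ω H]

/-- The Maurer-Cartan form at `x` as a linear equivalence, in the preferred chart. -/
def coframeEquiv (x : H) : E ≃ₗ[ℝ] E :=
  LinearEquiv.ofLinearMap (leftCoframe ℝ E x (chartAt E x x)).toLinearMap
    (leftFrame ℝ E x (chartAt E x x)).toLinearMap
    (congrArg ContinuousLinearMap.toLinearMap
      (leftCoframe_comp_leftFrame (𝕜 := ℝ) (mem_chart_target E x)))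
    (congrArg ContinuousLinearMap.toLinearMap
      (leftFrame_comp_leftCoframe (𝕜 := ℝ) (mem_chart_target E x)))

/-- The basis of the Lie algebra obtained by left translation of the coordinate basis at `x`. -/
def coframeBasis (x : H) : Module.Basis (Fin (Module.finrank ℝ E)) ℝ E :=
  (Module.finBasis ℝ E).map (coframeEquiv x)

theorem leftFrame_coframeBasis (x : H) (i : Fin (Module.finrank ℝ E)) :
    leftFrame ℝ E x (chartAt E x x) (coframeBasis x i) = Module.finBasis ℝ E i :=
  congrArg (fun l : E →L[ℝ] E => l (Module.finBasis ℝ E i))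
    (leftFrame_comp_leftCoframe (𝕜 := ℝ) (mem_chart_target E x))

/-- Chain rule for left translation after the inverse chart. It ties the intrinsic metric to
`leftCoframe`, on which all chart computations rest. -/
theorem leftTranslateToOne_coordVector (x₀ : H) {y : E} (hy : y ∈ (chartAt E x₀).target)
    (i : Fin (Module.finrank ℝ E)) :
    leftTranslateToOne (EG := E) ((extChartAt 𝓘(ℝ, E) x₀).symm y) (coordVector x₀ y i)
      = leftCoframe ℝ E x₀ y (Module.finBasis ℝ E i) := by
  have h1 : MDifferentiableAt 𝓘(ℝ, E) 𝓘(ℝ, E) (chartAt E x₀).symm y :=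
    (contMDiffAt_chartAt_symm_of_mem (𝕜 := ℝ) x₀ hy).mdifferentiableAt (by simp)
  have h2 : MDifferentiableAt 𝓘(ℝ, E) 𝓘(ℝ, E)
      (fun z : H => ((chartAt E x₀).symm y)⁻¹ * z) ((chartAt E x₀).symm y) :=
    (ContMDiffAt.mul (n := ω) contMDiffAt_const contMDiffAt_id).mdifferentiableAt (by simp)
  have h3 := mfderiv_comp y h2 h1
  have h4 : MDifferentiableAt 𝓘(ℝ, E) 𝓘(ℝ, E)
      ((fun z : H => ((chartAt E x₀).symm y)⁻¹ * z) ∘ (chartAt E x₀).symm) y := h2.comp y h1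
  have h5 : (mfderiv 𝓘(ℝ, E) 𝓘(ℝ, E)
      ((fun z : H => ((chartAt E x₀).symm y)⁻¹ * z) ∘ (chartAt E x₀).symm) y : E →L[ℝ] E)
      = leftCoframe ℝ E x₀ y := by
    refine h4.mfderiv.trans ?_
    simp only [writtenInExtChartAt, Function.comp_apply, inv_mul_cancel]
    simp only [mfld_simps, fderivWithin_univ]
    rfl
  rw [← h5]
  exact (congrArg (fun l : E →L[ℝ] E => l (Module.finBasis ℝ E i)) h3).symm

theorem metricMatrix_leftInvariantMetric
    (B : LinearMap.BilinForm ℝ E) (x₀ : H) {y : E}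
    (hy : y ∈ (chartAt E x₀).target) (i j : Fin (Module.finrank ℝ E)) :
    metricMatrix (leftInvariantMetric (EG := E) (G := H) B) x₀ y i j
      = B (leftCoframe ℝ E x₀ y (Module.finBasis ℝ E i))
          (leftCoframe ℝ E x₀ y (Module.finBasis ℝ E j)) := by
  rw [← leftTranslateToOne_coordVector x₀ hy i, ← leftTranslateToOne_coordVector x₀ hy j]
  rfl

/-- Differentiate the identity coframe ∘ frame = id, applied to the constant vector that the frame
sends to `v` at the base point. -/
theorem fderiv_leftCoframe (x₀ : H) (u v : E) :
    fderiv ℝ (leftCoframe ℝ E x₀) (chartAt E x₀ x₀) u v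
      = -leftCoframe ℝ E x₀ (chartAt E x₀ x₀) (fderiv ℝ (leftFrame ℝ E x₀) (chartAt E x₀ x₀) u
          (leftCoframe ℝ E x₀ (chartAt E x₀ x₀) v)) := by
  have hy := mem_chart_target E x₀
  set y := chartAt E x₀ x₀
  have h3 : HasFDerivAt (leftCoframe ℝ E x₀) (fderiv ℝ (leftCoframe ℝ E x₀) y) y :=
    ((contDiffAt_leftCoframe hy).differentiableAt (by simp)).hasFDerivAt
  have h4 : HasFDerivAt (leftFrame ℝ E x₀) (fderiv ℝ (leftFrame ℝ E x₀) y) y :=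
    ((contDiffAt_leftFrame hy).differentiableAt (by simp)).hasFDerivAt
  have h5 := h3.clm_apply (h4.clm_apply (hasFDerivAt_const (leftCoframe ℝ E x₀ y v) y))
  have h6 : (fun z => leftCoframe ℝ E x₀ z (leftFrame ℝ E x₀ z (leftCoframe ℝ E x₀ y v)))
      =ᶠ[nhds y] fun _ => leftCoframe ℝ E x₀ y v := by
    filter_upwards [(chartAt E x₀).open_target.mem_nhds hy] with z hz
    exact congrArg (fun l : E →L[ℝ] E => l _) (leftCoframe_comp_leftFrame (𝕜 := ℝ) hz)
  have h7 := h5.unique ((hasFDerivAt_const _ y).congr_of_eventuallyEq h6)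
  have h8 := congrArg (fun l : E →L[ℝ] E => l u) h7
  have h9 : leftFrame ℝ E x₀ y (leftCoframe ℝ E x₀ y v) = v :=
    congrArg (fun l : E →L[ℝ] E => l v) (leftFrame_comp_leftCoframe (𝕜 := ℝ) hy)
  simp [h9] at h8
  exact eq_neg_of_add_eq_zero_right h8

/-- The form `B` is constant, so only the two coframe factors are differentiated. The result has the
shape of the hypothesis on `d` in `sum_inv_mul_christoffel`. -/
theorem partialDeriv_metricMatrix_leftInvariantMetric
    (B : LinearMap.BilinForm ℝ E) (x₀ : H)
    (k i j : Fin (Module.finrank ℝ E)) :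
    partialDeriv k (fun z => metricMatrix (leftInvariantMetric (EG := E) (G := H) B) x₀ z i j) (chartAt E x₀ x₀)
      = -B
            (frameConnection ℝ x₀ (coframeBasis x₀ k) (coframeBasis x₀ i)) (coframeBasis x₀ j)
        - B (coframeBasis x₀ i)
            (frameConnection ℝ x₀ (coframeBasis x₀ k) (coframeBasis x₀ j)) := by
  have hy := mem_chart_target E x₀
  set y := chartAt E x₀ x₀ with hy'
  -- The form `B` as a continuous bilinear map, so that the product rule for derivatives applies.
  let Bc : E →L[ℝ] E →L[ℝ] ℝ := LinearMap.toContinuousLinearMap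
    ((LinearMap.toContinuousLinearMap : (E →ₗ[ℝ] ℝ) ≃ₗ[ℝ] E →L[ℝ] ℝ).toLinearMap ∘ₗ
      B)
  have h3 : HasFDerivAt (leftCoframe ℝ E x₀) (fderiv ℝ (leftCoframe ℝ E x₀) y) y :=
    ((contDiffAt_leftCoframe hy).differentiableAt (by simp)).hasFDerivAt
  have h4 := fun v : E => h3.clm_apply (hasFDerivAt_const v y)
  have h5 := (Bc.hasFDerivAt.comp y (h4 (Module.finBasis ℝ E i))).clm_apply
    (h4 (Module.finBasis ℝ E j))
  have h6 : (fun z => metricMatrix (leftInvariantMetric (EG := E) (G := H) B) x₀ z i j) =ᶠ[nhds y]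
      fun z => Bc (leftCoframe ℝ E x₀ z (Module.finBasis ℝ E i))
        (leftCoframe ℝ E x₀ z (Module.finBasis ℝ E j)) := by
    filter_upwards [(chartAt E x₀).open_target.mem_nhds hy] with z hz
    exact metricMatrix_leftInvariantMetric B x₀ hz i j
  rw [partialDeriv, (h5.congr_of_eventuallyEq h6).fderiv]
  have h7 := fderiv_leftCoframe x₀ (Module.finBasis ℝ E k) (Module.finBasis ℝ E i)
  have h8 := fderiv_leftCoframe x₀ (Module.finBasis ℝ E k) (Module.finBasis ℝ E j)
  rw [← hy'] at h7 h8
  simp only [add_apply, ContinuousLinearMap.comp_apply,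
    ContinuousLinearMap.flip_apply, zero_apply, map_zero, zero_add,
    frameConnection, LinearMap.mk₂_apply, ← hy', h7, h8, map_neg,
    neg_apply, Function.comp_apply]
  have h9 := leftFrame_coframeBasis x₀ k
  rw [← hy'] at h9
  have h10 : ∀ i, coframeBasis x₀ i = leftCoframe ℝ E x₀ y (Module.finBasis ℝ E i) := fun _ => rfl
  have h11 : ∀ v w, Bc v w = B v w := fun _ _ => rfl
  rw [h9, h10 i, h10 j, h11, h11]
  ring

variable (B : LinearMap.BilinForm ℝ E)

theorem metricMatrix_leftInvariantMetric_self (x : H) :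
    metricMatrix (leftInvariantMetric (EG := E) (G := H) B) x (extChartAt 𝓘(ℝ, E) x x)
      = LinearMap.BilinForm.toMatrix (coframeBasis x) B := by
  ext i j
  rw [LinearMap.BilinForm.toMatrix_apply]
  exact metricMatrix_leftInvariantMetric B x (mem_chart_target E x) i j

theorem partialDeriv_chartRep {φ : H → ℂ} {x : H} (hφ : ContMDiffAt 𝓘(ℝ, E) 𝓘(ℝ, ℂ) ω φ x)
    (i : Fin (Module.finrank ℝ E)) :
    partialDeriv i (chartRep φ x) (extChartAt 𝓘(ℝ, E) x x)
      = leftDeriv ℝ E φ x (coframeBasis x i) := by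
  have hx : (chartAt E x).symm (chartAt E x x) = x := (chartAt E x).left_inv (mem_chart_source E x)
  have h := leftDeriv_eq_fderiv_comp_leftFrame (f := φ) (mem_chart_target E x) (by rwa [hx])
  rw [hx] at h
  rw [h, ContinuousLinearMap.comp_apply, leftFrame_coframeBasis]
  rfl

theorem kappa_leftInvariantMetric (hs : ∀ X Y, B X Y = B Y X)
    {φ ψ : H → ℂ} {x : H} (hφ : ContMDiffAt 𝓘(ℝ, E) 𝓘(ℝ, ℂ) ω φ x)
    (hψ : ContMDiffAt 𝓘(ℝ, E) 𝓘(ℝ, ℂ) ω ψ x)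
    (hB : IsUnit (LinearMap.BilinForm.toMatrix (coframeBasis x) B)) :
    kappa (leftInvariantMetric (EG := E) (G := H) B) φ ψ x
      = ∑ i, ∑ j, (((LinearMap.BilinForm.toMatrix (coframeBasis x)
          B)⁻¹ i j : ℝ) : ℂ) *
          (leftDeriv ℝ E φ x (coframeBasis x i) * leftDeriv ℝ E ψ x (coframeBasis x j)) := by
  rw [← sum_mul_inv_mul_inv _ hB]
  · simp only [kappa, gradComponent, metricMatrix_leftInvariantMetric_self,
      partialDeriv_chartRep hφ, partialDeriv_chartRep hψ]
  · ext i j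
    exact hs _ _

/-- The derivatives of the frame cancel against the Christoffel symbols except for tr(ad Xᵢ). This
trace is kept: it complexifies together with the other terms. -/
theorem laplacian_leftInvariantMetric (hs : ∀ X Y, B X Y = B Y X)
    {φ : H → ℂ} {x : H} (hφ : ContMDiffAt 𝓘(ℝ, E) 𝓘(ℝ, ℂ) ω φ x)
    (hB : IsUnit (LinearMap.BilinForm.toMatrix (coframeBasis x) B)) :
    laplacian (leftInvariantMetric (EG := E) (G := H) B) φ x
      = ∑ i, ∑ j, (((LinearMap.BilinForm.toMatrix (coframeBasis x)
          B)⁻¹ i j : ℝ) : ℂ) *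
          (leftDeriv ℝ E (fun z => leftDeriv ℝ E φ z (coframeBasis x j)) x (coframeBasis x i)
            - (LinearMap.trace ℝ E (frameBracket ℝ x (coframeBasis x i)) : ℂ)
              * leftDeriv ℝ E φ x (coframeBasis x j)) := by
  have hsymm : (LinearMap.BilinForm.toMatrix (coframeBasis x)
      B).transpose
      = LinearMap.BilinForm.toMatrix (coframeBasis x) B := by
    ext i j
    exact hs _ _
  set ε := coframeBasis (E := E) x with hε
  set M := LinearMap.BilinForm.toMatrix ε B with hM
  have hx : (chartAt E x).symm (chartAt E x x) = x := (chartAt E x).left_inv (mem_chart_source E x)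
  have hy := mem_chart_target E x
  have hΦ : ContDiffAt ℝ ω (φ ∘ (chartAt E x).symm) (chartAt E x x) :=
    contDiffAt_comp_chart_symm hy (by rwa [hx])
  let a : Fin (Module.finrank ℝ E) → Fin (Module.finrank ℝ E) → Fin (Module.finrank ℝ E) → ℝ :=
    fun i j k => ε.repr (frameConnection ℝ x (ε i) (ε j)) k
  have ha : ∀ i j, frameConnection ℝ x (ε i) (ε j) = ∑ k, a i j k • ε k := fun i j =>
    (ε.sum_repr _).symm
  have hΓ := sum_inv_mul_christoffel M hB hsymm a
    (fun i j l => B (frameConnection ℝ x (ε i) (ε j)) (ε l))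
    (fun i j l => by
      rw [ha]
      simp [hM, LinearMap.BilinForm.toMatrix_apply])
    (fun i j l => partialDeriv i (fun z => metricMatrix (leftInvariantMetric (EG := E) (G := H) B) x z j l)
      (chartAt E x x))
    (fun i j l => by
      rw [partialDeriv_metricMatrix_leftInvariantMetric B]
      congr 1
      exact hs _ _)
  have ht : ∀ l, LinearMap.trace ℝ E (frameBracket ℝ x (ε l)) = ∑ i, (a l i i - a i l i) := by
    intro l
    rw [LinearMap.trace_eq_matrix_trace ℝ ε]
    simp [Matrix.trace, LinearMap.toMatrix_apply, frameBracket, a]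
  have hsi : ∀ i j, M⁻¹ i j = M⁻¹ j i := by
    intro i j
    have : M⁻¹.transpose = M⁻¹ := by rw [Matrix.transpose_nonsing_inv, hsymm]
    exact (congrFun (congrFun this i) j).symm
  have hfin := sum_inv_mul_hessian_sub_christoffel (fun i j => M⁻¹ i j) hsi
    (fun k i j => christoffel (leftInvariantMetric (EG := E) (G := H) B) x k i j (chartAt E x x)) a
    (fun i => LinearMap.trace ℝ E (frameBracket ℝ x (ε i)))
    (fun k => by
      have := hΓ k
      simp only [ht]
      rw [← this]
      have h0 : metricMatrix (leftInvariantMetric (EG := E) (G := H) B) x (chartAt E x x) = M :=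
        metricMatrix_leftInvariantMetric_self B x
      simp only [christoffel, h0])
    (fun i j => partialDeriv i (partialDeriv j (chartRep φ x)) (chartAt E x x))
    (fun k => leftDeriv ℝ E φ x (ε k))
  -- In the basis `ε` the frame is the coordinate frame at x, so the first term of the product rule
  -- is the chart Hessian and the second is the connection `a`.
  have hD : ∀ i j, leftDeriv ℝ E (fun z => leftDeriv ℝ E φ z (ε j)) x (ε i)
      = partialDeriv i (partialDeriv j (chartRep φ x)) (chartAt E x x)
        + ∑ k, (a i j k : ℂ) * leftDeriv ℝ E φ x (ε k) := by
    intro i j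
    rw [leftDeriv_leftDeriv hφ]
    congr 1
    · rw [hε, leftFrame_coframeBasis, leftFrame_coframeBasis]
      have h3 : HasFDerivAt (fderiv ℝ (φ ∘ (chartAt E x).symm))
          (fderiv ℝ (fderiv ℝ (φ ∘ (chartAt E x).symm)) (chartAt E x x)) (chartAt E x x) :=
        ((hΦ.fderiv_right (m := ω) le_top).differentiableAt (by simp)).hasFDerivAt
      have h4 := (h3.clm_apply (hasFDerivAt_const (Module.finBasis ℝ E j) _)).fderiv
      have h5 := congrArg (fun l : E →L[ℝ] ℂ => l (Module.finBasis ℝ E i)) h4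
      simp at h5
      exact h5.symm
    · have h6 : leftFrame ℝ E x (chartAt E x x) (frameConnection ℝ x (ε i) (ε j))
          = fderiv ℝ (leftFrame ℝ E x) (chartAt E x x) (leftFrame ℝ E x (chartAt E x x) (ε i))
            (ε j) :=
        congrArg (fun l : E →L[ℝ] E => l _) (leftFrame_comp_leftCoframe (𝕜 := ℝ) hy)
      have h7 := leftDeriv_eq_fderiv_comp_leftFrame (f := φ) hy (by rwa [hx])
      rw [← h6]
      rw [hx] at h7
      have h8 := congrArg (fun l : E →L[ℝ] ℂ => l (frameConnection ℝ x (ε i) (ε j))) h7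
      refine h8.symm.trans ?_
      simp only [ha, map_sum, map_smul, Complex.real_smul]
  refine Eq.trans ?_ (hfin.trans ?_)
  · have h0 := metricMatrix_leftInvariantMetric_self B x
    simp only [laplacian, h0, partialDeriv_chartRep hφ]
    rfl
  · simp only [hD]

end Metric

/-! ### The identity theorem for holomorphic functions -/

section Identity

variable {E : Type*} [NormedAddCommGroup E] [NormedSpace ℂ E]

/-- If all homogeneous terms below degree n vanish, the bound of order n + 1 makes the degree n term
O(‖y‖ⁿ⁺¹), which forces it to be zero. -/
theorem eventually_eq_zero_of_isBigO_pow {f : E → ℂ} {y₀ : E} (hf : AnalyticAt ℂ f y₀)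
    (h : ∀ n : ℕ, f =O[nhds y₀] fun y => ‖y - y₀‖ ^ n) : ∀ᶠ y in nhds y₀, f y = 0 := by
  obtain ⟨p, hp⟩ := hf
  have hO : ∀ n : ℕ, (fun y => f (y₀ + y)) =O[nhds 0] fun y => ‖y‖ ^ n := by
    intro n
    have ht : Filter.Tendsto (fun y : E => y₀ + y) (nhds 0) (nhds y₀) := by
      have : Continuous fun y : E => y₀ + y := by fun_prop
      simpa using this.tendsto 0
    simpa [Function.comp_def] using (h n).comp_tendsto ht
  have hp0 : ∀ n : ℕ, ∀ y : E, (p n fun _ => y) = 0 := by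
    intro n
    induction n using Nat.strong_induction_on with
    | _ n ih =>
      apply Asymptotics.IsBigO.continuousMultilinearMap_apply_eq_zero
      have h1 := hp.isBigO_sub_partialSum_pow (n + 1)
      have h2 := (hO (n + 1)).sub h1
      refine h2.congr_left fun y => ?_
      rw [FormalMultilinearSeries.partialSum, Finset.sum_range_succ,
        Finset.sum_eq_zero fun k hk => ih k (Finset.mem_range.1 hk) y]
      ring
  filter_upwards [hp.eventually_hasSum_sub] with y hy
  have : HasSum (fun _ : ℕ => (0 : ℂ)) (f y) := by simpa only [hp0] using hy
  exact this.unique hasSum_zero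

/-- Mean value inequality on the closed ball of radius ‖y − y₀‖, which contributes the extra factor.
-/
theorem isBigO_pow_succ_of_fderiv {f : E → ℂ} {y₀ : E} (n : ℕ)
    (hd : ∀ᶠ y in nhds y₀, DifferentiableAt ℂ f y) (h0 : f y₀ = 0)
    (h : fderiv ℂ f =O[nhds y₀] fun y => ‖y - y₀‖ ^ n) :
    f =O[nhds y₀] fun y => ‖y - y₀‖ ^ (n + 1) := by
  obtain ⟨C, hC⟩ := h.bound
  obtain ⟨r, hr, hball⟩ := Metric.eventually_nhds_iff_ball.1 (hd.and hC)
  refine Asymptotics.IsBigO.of_bound |C| ?_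
  filter_upwards [Metric.ball_mem_nhds y₀ hr] with y hy
  have hsub : Metric.closedBall y₀ ‖y - y₀‖ ⊆ Metric.ball y₀ r := by
    apply Metric.closedBall_subset_ball
    rwa [← dist_eq_norm]
  have hb : ∀ z ∈ Metric.closedBall y₀ ‖y - y₀‖, ‖fderiv ℂ f z‖ ≤ |C| * ‖y - y₀‖ ^ n := by
    intro z hz
    have h1 := (hball z (hsub hz)).2
    have h2 : ‖z - y₀‖ ≤ ‖y - y₀‖ := by rw [← dist_eq_norm]; exact hz
    rw [norm_pow, norm_norm] at h1
    calc _ ≤ C * ‖z - y₀‖ ^ n := h1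
      _ ≤ |C| * ‖z - y₀‖ ^ n := by gcongr; exact le_abs_self C
      _ ≤ _ := by gcongr
  have h3 := Convex.norm_image_sub_le_of_norm_fderiv_le (𝕜 := ℂ)
    (fun z hz => (hball z (hsub hz)).1) hb
    (@convex_closedBall E _ (NormedSpace.complexToReal) y₀ ‖y - y₀‖)
    (Metric.mem_closedBall_self (norm_nonneg _)) (y := y) (by simp [dist_eq_norm])
  rwa [h0, sub_zero, mul_assoc, ← pow_succ, ← norm_norm (y - y₀), ← norm_pow] at h3

variable {H : Type*} [TopologicalSpace H] [ChartedSpace E H]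

/-- The points near which h vanishes form an open set. Within the component it is also closed:
around a limit point, a ball in the chart contains such a point and the classical identity theorem
applies. -/
theorem eq_zero_of_mem_connectedComponentIn [IsManifold 𝓘(ℂ, E) ω H] {h : H → ℂ} {s : Set H}
    (hh : ∀ z ∈ s, ContMDiffAt 𝓘(ℂ, E) 𝓘(ℂ, ℂ) ω h z) {z z₀ : H} (hzs : z ∈ s)
    (hz₀ : z₀ ∈ connectedComponentIn s z) (h0 : ∀ᶠ w in nhds z₀, h w = 0) : h z = 0 := by
  have hsub : connectedComponentIn s z ⊆ {a | ∀ᶠ w in nhds a, h w = 0} := by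
    refine isPreconnected_connectedComponentIn.subset_of_closure_inter_subset
      isOpen_setOfPred_eventually_nhds ⟨z₀, hz₀, h0⟩ ?_
    rintro a ⟨hacl, has⟩
    have haS : a ∈ s := connectedComponentIn_subset s z has
    have hc : (chartAt E a).symm (chartAt E a a) = a :=
      (chartAt E a).left_inv (mem_chart_source E a)
    have hy := mem_chart_target E a
    have h1 : AnalyticAt ℂ (h ∘ (chartAt E a).symm) (chartAt E a a) :=
      (contDiffAt_comp_chart_symm (𝕜 := ℂ) hy (by rw [hc]; exact hh a haS)).analyticAt
    obtain ⟨r, hr, hball⟩ := Metric.eventually_nhds_iff_ball.1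
      (h1.eventually_analyticAt.and ((chartAt E a).open_target.mem_nhds hy))
    have hca := (chartAt E a).continuousAt (mem_chart_source E a)
    have hN : ∀ᶠ w in nhds a, w ∈ (chartAt E a).source ∧
        chartAt E a w ∈ Metric.ball (chartAt E a a) r :=
      Filter.Eventually.and ((chartAt E a).open_source.mem_nhds (mem_chart_source E a))
        (hca.eventually (Metric.ball_mem_nhds _ hr))
    obtain ⟨b, hb0, hb1⟩ := (mem_closure_iff_frequently.1 hacl).and_eventually hN |>.exists
    have hcb : (chartAt E a).symm (chartAt E a b) = b := (chartAt E a).left_inv hb1.1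
    have hbs : Filter.Tendsto (chartAt E a).symm (nhds (chartAt E a b)) (nhds b) := by
      have := (chartAt E a).continuousAt_symm ((chartAt E a).map_source hb1.1)
      rwa [ContinuousAt, hcb] at this
    have hz := AnalyticOnNhd.eqOn_zero_of_preconnected_of_eventuallyEq_zero
      (fun y hy => (hball y hy).1) Metric.isPreconnected_ball hb1.2 (hbs.eventually hb0)
    filter_upwards [hN] with w hw
    have := hz hw.2
    simpa [(chartAt E a).left_inv hw.1] using this
  exact (hsub (mem_connectedComponentIn hzs)).self_of_nhds

variable [Group H] [LieGroup 𝓘(ℂ, E) ω H] [FiniteDimensional ℂ E]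

/-- A family of holomorphic functions vanishing at a point which is stable under the derivatives
along left-invariant vector fields vanishes to infinite order at this point. -/
theorem isBigO_pow_of_leftDeriv_stable (z₀ : H) (S : Set (H → ℂ))
    (hS : ∀ h ∈ S, ContMDiffAt 𝓘(ℂ, E) 𝓘(ℂ, ℂ) ω h z₀) (hS0 : ∀ h ∈ S, h z₀ = 0)
    (hSd : ∀ h ∈ S, ∀ Z : E, (fun z => leftDeriv ℂ E h z Z) ∈ S) (n : ℕ) :
    ∀ h ∈ S, (h ∘ (chartAt E z₀).symm) =O[nhds (chartAt E z₀ z₀)]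
      fun y => ‖y - chartAt E z₀ z₀‖ ^ n := by
  have hz : (chartAt E z₀).symm (chartAt E z₀ z₀) = z₀ :=
    (chartAt E z₀).left_inv (mem_chart_source E z₀)
  have hy := mem_chart_target E z₀
  have hreg : ∀ h ∈ S, ContDiffAt ℂ ω (h ∘ (chartAt E z₀).symm) (chartAt E z₀ z₀) :=
    fun h hh => contDiffAt_comp_chart_symm hy (by rw [hz]; exact hS h hh)
  induction n with
  | zero =>
    intro h hh
    simpa using (hreg h hh).continuousAt.isBigO_one ℝ
  | succ n ih =>
    intro h hh
    apply isBigO_pow_succ_of_fderiv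
    · filter_upwards [(hreg h hh).eventually (by simp)] with y hy
      exact hy.differentiableAt (by simp)
    · simp [hz, hS0 h hh]
    -- In the chart the derivative of h is its left derivative composed with the coframe. The
    -- induction hypothesis bounds the left derivatives along a basis, and the coframe is locally
    -- bounded.
    · let b := Module.finBasis ℂ E
      obtain ⟨C, hC, hbC⟩ := b.exists_opNorm_le (F := ℂ)
      have h1 : (fun y => leftDeriv ℂ E h ((chartAt E z₀).symm y)) =O[nhds (chartAt E z₀ z₀)]
          fun y => ‖y - chartAt E z₀ z₀‖ ^ n := by
        have h2 : (fun y => ∑ i, ‖leftDeriv ℂ E h ((chartAt E z₀).symm y) (b i)‖)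
            =O[nhds (chartAt E z₀ z₀)] fun y => ‖y - chartAt E z₀ z₀‖ ^ n :=
          Asymptotics.IsBigO.fun_sum fun i _ => (ih _ (hSd h hh (b i))).norm_left
        refine Asymptotics.IsBigO.trans (Asymptotics.IsBigO.of_bound C ?_) h2
        refine Filter.Eventually.of_forall fun y => ?_
        have hnn : 0 ≤ ∑ i, ‖leftDeriv ℂ E h ((chartAt E z₀).symm y) (b i)‖ :=
          Finset.sum_nonneg fun i _ => norm_nonneg _
        rw [Real.norm_of_nonneg hnn]
        exact hbC hnn fun i => Finset.single_le_sum
          (f := fun i => ‖leftDeriv ℂ E h ((chartAt E z₀).symm y) (b i)‖)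
          (fun i _ => norm_nonneg _) (Finset.mem_univ i)
      have h3 : leftCoframe ℂ E z₀ =O[nhds (chartAt E z₀ z₀)] fun _ => (1 : ℝ) :=
        (contDiffAt_leftCoframe hy).continuousAt.isBigO_one ℝ
      have h4 : fderiv ℂ (h ∘ (chartAt E z₀).symm) =ᶠ[nhds (chartAt E z₀ z₀)] fun y =>
          (leftDeriv ℂ E h ((chartAt E z₀).symm y)).comp (leftCoframe ℂ E z₀ y) := by
        have hc := (chartAt E z₀).continuousAt_symm hy
        have : IsManifold 𝓘(ℂ, E) 1 H := IsManifold.of_le (n := ω) le_top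
        have hev : ∀ᶠ z in nhds (chartAt E z₀ z₀),
            ContMDiffAt 𝓘(ℂ, E) 𝓘(ℂ, ℂ) ω h ((chartAt E z₀).symm z) :=
          hc.eventually ((contMDiffAt_iff_contMDiffAt_nhds (by simp)).1
            (by rw [hz]; exact hS h hh))
        filter_upwards [hev, (chartAt E z₀).open_target.mem_nhds hy] with y hy1 hy2
        rw [leftDeriv_eq_fderiv_comp_leftFrame hy2 hy1, ContinuousLinearMap.comp_assoc,
          leftFrame_comp_leftCoframe hy2, ContinuousLinearMap.comp_id]
      refine (Asymptotics.IsBigO.congr' ?_ h4.symm Filter.EventuallyEq.rfl)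
      have h5 := h1.norm_left.mul h3.norm_left
      simp only [mul_one] at h5
      exact (Asymptotics.IsBigO.of_bound 1 (Filter.Eventually.of_forall fun y => by
        rw [one_mul, Real.norm_of_nonneg (by positivity)]
        exact ContinuousLinearMap.opNorm_comp_le _ _)).trans h5

theorem eventually_eq_zero_of_leftDeriv_stable (z₀ : H) (S : Set (H → ℂ))
    (hS : ∀ h ∈ S, ContMDiffAt 𝓘(ℂ, E) 𝓘(ℂ, ℂ) ω h z₀) (hS0 : ∀ h ∈ S, h z₀ = 0)
    (hSd : ∀ h ∈ S, ∀ Z : E, (fun z => leftDeriv ℂ E h z Z) ∈ S) {h : H → ℂ} (hh : h ∈ S) :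
    ∀ᶠ z in nhds z₀, h z = 0 := by
  have hz : (chartAt E z₀).symm (chartAt E z₀ z₀) = z₀ :=
    (chartAt E z₀).left_inv (mem_chart_source E z₀)
  have hy := mem_chart_target E z₀
  have h1 : ContDiffAt ℂ ω (h ∘ (chartAt E z₀).symm) (chartAt E z₀ z₀) :=
    contDiffAt_comp_chart_symm hy (by rw [hz]; exact hS h hh)
  have h2 := eventually_eq_zero_of_isBigO_pow h1.analyticAt
    fun n => isBigO_pow_of_leftDeriv_stable z₀ S hS hS0 hSd n h hh
  have hc : ContinuousAt (chartAt E z₀) z₀ := (chartAt E z₀).continuousAt (mem_chart_source E z₀)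
  filter_upwards [hc.eventually h2, (chartAt E z₀).open_source.mem_nhds (mem_chart_source E z₀)]
    with z hz1 hz2
  simpa [(chartAt E z₀).left_inv hz2] using hz1

end Identity

/-! ### Commutators and pull-back along homomorphisms -/

section LeftDeriv

variable {𝕜 : Type*} [RCLike 𝕜] {E : Type*} [NormedAddCommGroup E] [NormedSpace 𝕜 E]
variable {H : Type*} [TopologicalSpace H] [ChartedSpace E H] [Group H] [LieGroup 𝓘(𝕜, E) ω H]
variable {F : Type*} [NormedAddCommGroup F] [NormedSpace 𝕜 F]

theorem leftDeriv_apply_const {f : H → F} {x : H} (hf : ContMDiffAt 𝓘(𝕜, E) 𝓘(𝕜, F) ω f x)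
    (X Y : E) :
    leftDeriv 𝕜 E (fun z => leftDeriv 𝕜 E f z Y) x X = leftDeriv 𝕜 E (leftDeriv 𝕜 E f) x X Y := by
  have h1 := hasFDerivAt_leftDeriv (contMDiffAt_leftDeriv hf)
  have h2 := (h1.clm_apply (hasFDerivAt_const Y _)).fderiv
  have h3 := congrArg (fun l : E →L[𝕜] F => l X) h2
  refine h3.trans ?_
  simp

/-- The second derivatives in the chart are symmetric and cancel, leaving the antisymmetrised
derivative of the frame. -/
theorem leftDeriv_comm [FiniteDimensional 𝕜 E] {f : H → F} {x : H}
    (hf : ContMDiffAt 𝓘(𝕜, E) 𝓘(𝕜, F) ω f x) (X Y : E) :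
    leftDeriv 𝕜 E (fun z => leftDeriv 𝕜 E f z Y) x X
      - leftDeriv 𝕜 E (fun z => leftDeriv 𝕜 E f z X) x Y
      = leftDeriv 𝕜 E f x (frameBracket 𝕜 x X Y) := by
  have hx : (chartAt E x).symm (chartAt E x x) = x := (chartAt E x).left_inv (mem_chart_source E x)
  have hy := mem_chart_target E x
  have hΦ : ContDiffAt 𝕜 ω (f ∘ (chartAt E x).symm) (chartAt E x x) :=
    contDiffAt_comp_chart_symm hy (by rwa [hx])
  have hsymm := hΦ.isSymmSndFDerivAt (by simp)
  have h7 := leftDeriv_eq_fderiv_comp_leftFrame (f := f) hy (by rwa [hx])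
  rw [hx] at h7
  have h6 : ∀ v, leftFrame 𝕜 E x (chartAt E x x) (leftCoframe 𝕜 E x (chartAt E x x) v) = v :=
    fun v => congrArg (fun l : E →L[𝕜] E => l v) (leftFrame_comp_leftCoframe (𝕜 := 𝕜) hy)
  rw [leftDeriv_leftDeriv hf, leftDeriv_leftDeriv hf, hsymm.eq, h7]
  simp [frameBracket, frameConnection, h6]

end LeftDeriv

section RestrictScalars

variable {EC : Type*} [NormedAddCommGroup EC] [NormedSpace ℂ EC]
variable {GC : Type*} [TopologicalSpace GC] [ChartedSpace EC GC]
variable {F : Type*} [NormedAddCommGroup F] [NormedSpace ℂ F]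

theorem ContMDiffAt.real_of_complex {f : GC → F} {z : GC}
    (hf : ContMDiffAt 𝓘(ℂ, EC) 𝓘(ℂ, F) ω f z) : ContMDiffAt 𝓘(ℝ, EC) 𝓘(ℝ, F) ω f z := by
  rw [contMDiffAt_iff] at hf ⊢
  exact ⟨hf.1, hf.2.restrict_scalars ℝ⟩

end RestrictScalars

section Hom

variable {E : Type*} [NormedAddCommGroup E] [NormedSpace ℝ E]
variable {H : Type*} [TopologicalSpace H] [ChartedSpace E H] [Group H]
variable {EC : Type*} [NormedAddCommGroup EC] [NormedSpace ℂ EC]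
variable {GC : Type*} [TopologicalSpace GC] [ChartedSpace EC GC] [Group GC]
variable {F : Type*} [NormedAddCommGroup F] [NormedSpace ℂ F]

/-- The differential at the identity of a homomorphism, as a map between the model spaces. -/
def homDifferential (f : H →* GC) : E →ₗ[ℝ] EC := differentialAtOne (EG := E) (EC := EC) f

theorem hasFDerivAt_hom {f : H →* GC} (hf : ContMDiff 𝓘(ℝ, E) 𝓘(ℝ, EC) ω f) :
    HasFDerivAt (fun u => chartAt EC (1 : GC) (f ((chartAt E (1 : H)).symm u)))
      (mfderiv 𝓘(ℝ, E) 𝓘(ℝ, EC) f 1 : E →L[ℝ] EC) (chartAt E (1 : H) 1) := by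
  have h := ((hf 1).mdifferentiableAt (by simp)).hasMFDerivAt.2
  simp only [writtenInExtChartAt, map_one] at h
  simp only [mfld_simps] at h
  exact hasFDerivWithinAt_univ.1 h

theorem contMDiffAt_comp_hom {f : H →* GC} (hf : ContMDiff 𝓘(ℝ, E) 𝓘(ℝ, EC) ω f) {φ : GC → F}
    {x : H} (hφ : ContMDiffAt 𝓘(ℂ, EC) 𝓘(ℂ, F) ω φ (f x)) :
    ContMDiffAt 𝓘(ℝ, E) 𝓘(ℝ, F) ω (fun z => φ (f z)) x :=
  ContMDiffAt.comp x hφ.real_of_complex (hf x)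

variable [LieGroup 𝓘(ℂ, EC) ω GC]

/-- Since f(xu) = f(x)f(u), only the differential of f at 1 enters. The real derivative on the left
becomes the restriction of a complex linear map. -/
theorem leftDeriv_comp_hom {f : H →* GC} (hf : ContMDiff 𝓘(ℝ, E) 𝓘(ℝ, EC) ω f) {φ : GC → F} {x : H}
    (hφ : ContMDiffAt 𝓘(ℂ, EC) 𝓘(ℂ, F) ω φ (f x)) (X : E) :
    leftDeriv ℝ E (fun z => φ (f z)) x X = leftDeriv ℂ EC φ (f x) (homDifferential f X) := by
  have h1 := hasFDerivAt_hom hf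
  have h2 := (hasFDerivAt_leftDeriv hφ).restrictScalars ℝ
  have hone : chartAt EC (1 : GC) (f ((chartAt E (1 : H)).symm (chartAt E (1 : H) 1)))
      = chartAt EC (1 : GC) 1 := by simp
  rw [← hone] at h2
  have h3 := HasFDerivAt.comp (chartAt E (1 : H) 1) h2 h1
  have hev : (fun u => φ (f (x * (chartAt E (1 : H)).symm u))) =ᶠ[nhds (chartAt E (1 : H) 1)]
      ((fun u => φ (f x * (chartAt EC (1 : GC)).symm u)) ∘
        fun u => chartAt EC (1 : GC) (f ((chartAt E (1 : H)).symm u))) := by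
    have hc : ContinuousAt (fun u => f ((chartAt E (1 : H)).symm u)) (chartAt E (1 : H) 1) :=
      ContinuousAt.comp (hf.continuous.continuousAt)
        ((chartAt E (1 : H)).continuousAt_symm (mem_chart_target E (1 : H)))
    have hm : (chartAt EC (1 : GC)).source ∈
        nhds (f ((chartAt E (1 : H)).symm (chartAt E (1 : H) 1))) := by
      simpa using (chartAt EC (1 : GC)).open_source.mem_nhds (mem_chart_source EC (1 : GC))
    filter_upwards [hc.eventually hm] with u hu
    simp [(chartAt EC (1 : GC)).left_inv hu]
  have h4 := (h3.congr_of_eventuallyEq hev).fderiv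
  exact congrArg (fun l : E →L[ℝ] F => l X) h4

variable [LieGroup 𝓘(ℝ, E) ω H]

theorem leftDeriv_leftDeriv_comp_hom {f : H →* GC} (hf : ContMDiff 𝓘(ℝ, E) 𝓘(ℝ, EC) ω f)
    {φ : GC → F} {x : H} (hφ : ContMDiffAt 𝓘(ℂ, EC) 𝓘(ℂ, F) ω φ (f x)) (X Y : E) :
    leftDeriv ℝ E (fun z => leftDeriv ℝ E (fun w => φ (f w)) z Y) x X
      = leftDeriv ℂ EC (leftDeriv ℂ EC φ) (f x) (homDifferential f X) (homDifferential f Y) := by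
  have : ContinuousMul H := continuousMul_of_contMDiffMul 𝓘(ℝ, E) ω
  have : IsManifold 𝓘(ℂ, EC) 1 GC := IsManifold.of_le (n := ω) le_top
  have hev : (fun z => leftDeriv ℝ E (fun w => φ (f w)) z Y) =ᶠ[nhds x]
      fun z => leftDeriv ℂ EC φ (f z) (homDifferential f Y) := by
    filter_upwards [hf.continuous.continuousAt.eventually
      ((contMDiffAt_iff_contMDiffAt_nhds (by simp)).1 hφ)] with z hz
    exact leftDeriv_comp_hom hf hz Y
  rw [leftDeriv_congr hev, ← leftDeriv_apply_const hφ]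
  exact leftDeriv_comp_hom (φ := fun z => leftDeriv ℂ EC φ z (homDifferential f Y)) hf
    ((contMDiffAt_leftDeriv hφ).clm_apply contMDiffAt_const) X

variable (EC GC) in
/-- The commutator of left-invariant holomorphic vector fields, in the preferred chart at `1`. -/
def complexBracket : EC →ₗ[ℂ] EC →ₗ[ℂ] EC :=
  LinearMap.mk₂ ℂ (fun Z Z' =>
    leftDeriv ℂ EC (leftDeriv ℂ EC (chartAt EC (1 : GC))) (1 : GC) Z Z'
      - leftDeriv ℂ EC (leftDeriv ℂ EC (chartAt EC (1 : GC))) (1 : GC) Z' Z)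
    (fun _ _ _ => by simp only [map_add, add_apply]; abel)
    (fun _ _ _ => by simp only [map_smul, smul_apply, smul_sub])
    (fun _ _ _ => by simp only [map_add, add_apply]; abel)
    (fun _ _ _ => by simp only [map_smul, smul_apply, smul_sub])

/-- Both commutators are tested on z ↦ chart₁(f(x)⁻¹z), whose left derivative at f(x) is the
identity. The right side involves neither the point nor the metric, so both real forms inherit their
bracket from one complex bracket. -/
theorem homDifferential_frameBracket [FiniteDimensional ℝ E] {f : H →* GC}
    (hf : ContMDiff 𝓘(ℝ, E) 𝓘(ℝ, EC) ω f) (x : H) (X Y : E) :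
    homDifferential f (frameBracket ℝ x X Y)
      = complexBracket EC GC (homDifferential f X) (homDifferential f Y) := by
  set φ : GC → EC := fun z => chartAt EC (1 : GC) ((f x)⁻¹ * z) with hφdef
  have h0 := contMDiffAt_chartAt_of_mem (𝕜 := ℂ) (1 : GC) (mem_chart_source EC (1 : GC))
  have hφ : ContMDiffAt 𝓘(ℂ, EC) 𝓘(ℂ, EC) ω φ (f x) := by
    refine ContMDiffAt.comp (f x) (g := chartAt EC (1 : GC)) (by simpa using h0) ?_
    exact ContMDiffAt.mul contMDiffAt_const contMDiffAt_id
  have h1 := leftDeriv_comm (contMDiffAt_comp_hom hf hφ) X Y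
  rw [leftDeriv_leftDeriv_comp_hom hf hφ, leftDeriv_leftDeriv_comp_hom hf hφ,
    leftDeriv_comp_hom hf hφ] at h1
  have h2 : leftDeriv ℂ EC φ (f x) = ContinuousLinearMap.id ℂ EC := by
    rw [hφdef, leftDeriv_mul_left, inv_mul_cancel, leftDeriv_chart_one]
  have h3 : leftDeriv ℂ EC (leftDeriv ℂ EC φ) (f x)
      = leftDeriv ℂ EC (leftDeriv ℂ EC (chartAt EC (1 : GC))) (1 : GC) := by
    have : leftDeriv ℂ EC φ = fun z => leftDeriv ℂ EC (chartAt EC (1 : GC)) ((f x)⁻¹ * z) := by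
      funext z
      rw [hφdef, leftDeriv_mul_left]
    rw [this, leftDeriv_mul_left (leftDeriv ℂ EC (chartAt EC (1 : GC))), inv_mul_cancel]
  rw [h2, h3] at h1
  exact h1.symm

end Hom

/-! ### Linear algebra of complexifications -/

section ComplexBasis

variable {V : Type*} [AddCommGroup V] [Module ℝ V]
variable {VC : Type*} [AddCommGroup VC] [Module ℂ VC] [Module ℝ VC] [IsScalarTower ℝ ℂ VC]
variable {ι : Type*} [Fintype ι]

theorem real_smul_eq_complex_smul (r : ℝ) (v : VC) : r • v = (r : ℂ) • v :=
  (algebraMap_smul ℂ r v).symm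

/-- The complex basis of a complexification given by a real basis. -/
def complexBasis (d : V →ₗ[ℝ] VC)
    (hd : Function.Bijective fun q : V × V => d q.1 + Complex.I • d q.2)
    (b : Module.Basis ι ℝ V) : Module.Basis ι ℂ VC :=
  Module.Basis.mk (v := fun i => d (b i))
    (by
      rw [Fintype.linearIndependent_iff]
      intro g hg i
      -- A complex relation splits into real and imaginary parts, which vanish separately by
      -- injectivity on pairs.
      have h1 : d (∑ i, (g i).re • b i) + Complex.I • d (∑ i, (g i).im • b i) = 0 := by
        rw [← hg, map_sum, map_sum, Finset.smul_sum, ← Finset.sum_add_distrib]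
        refine Finset.sum_congr rfl fun i _ => ?_
        conv_rhs => rw [← Complex.re_add_im (g i)]
        rw [map_smul, map_smul, add_smul, mul_comm, mul_smul, real_smul_eq_complex_smul,
          real_smul_eq_complex_smul]
      have h2 := @hd.1 (∑ i, (g i).re • b i, ∑ i, (g i).im • b i) (0, 0) (by simpa using h1)
      rw [Prod.mk.injEq] at h2
      have h3 := Fintype.linearIndependent_iff.1 b.linearIndependent _ h2.1 i
      have h4 := Fintype.linearIndependent_iff.1 b.linearIndependent _ h2.2 i
      exact Complex.ext h3 h4)
    (by
      rintro z -
      obtain ⟨q, rfl⟩ := hd.2 z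
      have hmem : ∀ v, d v ∈ Submodule.span ℂ (Set.range fun i => d (b i)) := by
        intro v
        rw [← b.sum_repr v, map_sum]
        refine Submodule.sum_mem _ fun i _ => ?_
        rw [map_smul, real_smul_eq_complex_smul]
        exact Submodule.smul_mem _ _ (Submodule.subset_span ⟨i, rfl⟩)
      exact Submodule.add_mem _ (hmem _) (Submodule.smul_mem _ _ (hmem _)))

@[simp]
theorem complexBasis_apply (d : V →ₗ[ℝ] VC)
    (hd : Function.Bijective fun q : V × V => d q.1 + Complex.I • d q.2)
    (b : Module.Basis ι ℝ V) (i : ι) : complexBasis d hd b i = d (b i) := by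
  simp [complexBasis]

theorem complexBasis_repr (d : V →ₗ[ℝ] VC)
    (hd : Function.Bijective fun q : V × V => d q.1 + Complex.I • d q.2)
    (b : Module.Basis ι ℝ V) (v : V) (i : ι) :
    (complexBasis d hd b).repr (d v) i = (b.repr v i : ℂ) := by
  have h : d v = ∑ k, (b.repr v k : ℂ) • complexBasis d hd b k := by
    conv_lhs => rw [← b.sum_repr v]
    simp only [map_sum, map_smul, real_smul_eq_complex_smul, complexBasis_apply]
  rw [h, Module.Basis.repr_sum_self]

/-- In a real basis and the complex basis it induces, the two operators have the same matrix. -/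
theorem trace_complexification (d : V →ₗ[ℝ] VC)
    (hd : Function.Bijective fun q : V × V => d q.1 + Complex.I • d q.2)
    (b : Module.Basis ι ℝ V) [DecidableEq ι] (l : V →ₗ[ℝ] V) (l' : VC →ₗ[ℂ] VC)
    (h : ∀ v, d (l v) = l' (d v)) : LinearMap.trace ℂ VC l' = (LinearMap.trace ℝ V l : ℂ) := by
  rw [LinearMap.trace_eq_matrix_trace ℝ b, LinearMap.trace_eq_matrix_trace ℂ (complexBasis d hd b)]
  simp [Matrix.trace, LinearMap.toMatrix_apply, ← h, complexBasis_repr]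

theorem exists_complexified_bilinForm (d : V →ₗ[ℝ] VC)
    (hd : Function.Bijective fun q : V × V => d q.1 + Complex.I • d q.2)
    (b : Module.Basis ι ℝ V) [DecidableEq ι] (B : LinearMap.BilinForm ℝ V) :
    ∃ BC : LinearMap.BilinForm ℂ VC, ∀ v w, BC (d v) (d w) = (B v w : ℂ) := by
  refine ⟨Matrix.toBilin (complexBasis d hd b) (Matrix.of fun i j => (B (b i) (b j) : ℂ)), ?_⟩
  intro v w
  rw [Matrix.toBilin_apply]
  simp only [complexBasis_repr, Matrix.of_apply]
  conv_rhs => rw [← b.sum_repr v, ← b.sum_repr w]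
  simp only [map_sum, map_smul, LinearMap.sum_apply, LinearMap.smul_apply, smul_eq_mul]
  push_cast
  rw [Finset.sum_comm]
  refine Finset.sum_congr rfl fun i _ => ?_
  rw [Finset.mul_sum]
  exact Finset.sum_congr rfl fun j _ => by ring

end ComplexBasis

section Gram

variable {V : Type*} [AddCommGroup V] [Module ℝ V]
variable {VC : Type*} [AddCommGroup VC] [Module ℂ VC] [Module ℝ VC] [IsScalarTower ℝ ℂ VC]
variable {ι : Type*} [Fintype ι] [DecidableEq ι]

theorem toMatrix_complexBasis (d : V →ₗ[ℝ] VC)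
    (hd : Function.Bijective fun q : V × V => d q.1 + Complex.I • d q.2)
    (b : Module.Basis ι ℝ V) (B : LinearMap.BilinForm ℝ V) (BC : LinearMap.BilinForm ℂ VC)
    (s : ℝ) (hBC : ∀ X Y, BC (d X) (d Y) = ((s * B X Y : ℝ) : ℂ)) :
    LinearMap.BilinForm.toMatrix (complexBasis d hd b) BC
      = (s • LinearMap.BilinForm.toMatrix b B).map Complex.ofRealHom := by
  ext i j
  rw [LinearMap.BilinForm.toMatrix_apply, complexBasis_apply, complexBasis_apply, hBC]
  simp [LinearMap.BilinForm.toMatrix_apply]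

theorem isUnit_toMatrix_of_complexified (d : V →ₗ[ℝ] VC)
    (hd : Function.Bijective fun q : V × V => d q.1 + Complex.I • d q.2)
    (b : Module.Basis ι ℝ V) (B : LinearMap.BilinForm ℝ V) (BC : LinearMap.BilinForm ℂ VC)
    (s : ℝ) (hBC : ∀ X Y, BC (d X) (d Y) = ((s * B X Y : ℝ) : ℂ)) (hnd : BC.Nondegenerate) :
    IsUnit (LinearMap.BilinForm.toMatrix b B) := by
  have h1 := (LinearMap.BilinForm.nondegenerate_iff_det_ne_zero (complexBasis d hd b)).1 hnd
  rw [toMatrix_complexBasis d hd b B BC s hBC, ← RingHom.mapMatrix_apply, ← RingHom.map_det,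
    Matrix.det_smul, map_mul] at h1
  rw [Matrix.isUnit_iff_isUnit_det, isUnit_iff_ne_zero]
  intro h0
  exact h1 (by rw [h0, map_zero, mul_zero])

/-- The sign s is its own inverse, so the inverse Gram matrix acquires the factor s as well. The
value 1 serves the original group and −1 its dual. -/
theorem metricTrace_complexBasis (d : V →ₗ[ℝ] VC)
    (hd : Function.Bijective fun q : V × V => d q.1 + Complex.I • d q.2)
    (b : Module.Basis ι ℝ V) (B : LinearMap.BilinForm ℝ V) (BC : LinearMap.BilinForm ℂ VC)
    (s : ℝ) (hs : s * s = 1) (hBC : ∀ X Y, BC (d X) (d Y) = ((s * B X Y : ℝ) : ℂ))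
    (hnd : BC.Nondegenerate) (T : VC →ₗ[ℂ] VC →ₗ[ℂ] ℂ) :
    metricTrace (complexBasis d hd b) BC T
      = s * ∑ i, ∑ j, (((LinearMap.BilinForm.toMatrix b B)⁻¹ i j : ℝ) : ℂ) * T (d (b i)) (d (b j)) := by
  have hu := isUnit_toMatrix_of_complexified d hd b B BC s hBC hnd
  have hinv : (LinearMap.BilinForm.toMatrix (complexBasis d hd b) BC)⁻¹
      = (s • (LinearMap.BilinForm.toMatrix b B)⁻¹).map Complex.ofRealHom := by
    apply Matrix.inv_eq_left_inv
    rw [toMatrix_complexBasis d hd b B BC s hBC, ← Matrix.map_mul, smul_mul_smul_comm, hs, one_smul,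
      Matrix.nonsing_inv_mul _ ((Matrix.isUnit_iff_isUnit_det _).1 hu)]
    simp
  rw [metricTrace, hinv, Finset.mul_sum]
  refine Finset.sum_congr rfl fun i _ => ?_
  rw [Finset.mul_sum]
  refine Finset.sum_congr rfl fun j _ => ?_
  rw [complexBasis_apply, complexBasis_apply]
  simp [mul_assoc]

end Gram

/-! ### The eigenvalue equations on the complex group -/

section MetricTraceRegularity

variable {EC : Type*} [NormedAddCommGroup EC] [NormedSpace ℂ EC]
variable {GC : Type*} [TopologicalSpace GC] [ChartedSpace EC GC]

theorem contMDiffAt_const_mul {φ : GC → ℂ} {z : GC} (c : ℂ)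
    (hφ : ContMDiffAt 𝓘(ℂ, EC) 𝓘(ℂ, ℂ) ω φ z) :
    ContMDiffAt 𝓘(ℂ, EC) 𝓘(ℂ, ℂ) ω (fun w => c * φ w) z :=
  ContMDiffAt.smul (contMDiffAt_const : ContMDiffAt 𝓘(ℂ, EC) 𝓘(ℂ, ℂ) ω (fun _ : GC => c) z) hφ

variable {κ : Type*} [Fintype κ] [DecidableEq κ]
  (b : Module.Basis κ ℂ EC) (BC : LinearMap.BilinForm ℂ EC)

theorem contMDiffAt_metricTrace {T : GC → EC →ₗ[ℂ] EC →ₗ[ℂ] ℂ} {z : GC}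
    (hT : ∀ Z Z', ContMDiffAt 𝓘(ℂ, EC) 𝓘(ℂ, ℂ) ω (fun w => T w Z Z') z) :
    ContMDiffAt 𝓘(ℂ, EC) 𝓘(ℂ, ℂ) ω (fun w => metricTrace b BC (T w)) z := by
  unfold metricTrace
  exact contMDiffAt_finsetSum fun i _ => contMDiffAt_finsetSum fun j _ =>
    contMDiffAt_const_mul _ (hT _ _)

end MetricTraceRegularity

section Eigen

variable {E : Type*} [NormedAddCommGroup E] [NormedSpace ℝ E]
variable {H : Type*} [TopologicalSpace H] [ChartedSpace E H] [Group H]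
variable {EC : Type*} [NormedAddCommGroup EC] [NormedSpace ℂ EC]
variable {GC : Type*} [TopologicalSpace GC] [ChartedSpace EC GC] [Group GC]

variable (EC) in
/-- The bilinear form on the complex Lie algebra whose metric trace is the holomorphic Laplacian. -/
def leftHessian (φ : GC → ℂ) (z : GC) : EC →ₗ[ℂ] EC →ₗ[ℂ] ℂ :=
  LinearMap.mk₂ ℂ (fun Z Z' => leftDeriv ℂ EC (leftDeriv ℂ EC φ) z Z Z'
      - LinearMap.trace ℂ EC (complexBracket EC GC Z) * leftDeriv ℂ EC φ z Z')
    (fun _ _ _ => by simp only [map_add, add_apply]; ring)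
    (fun _ _ _ => by simp only [map_smul, smul_apply, smul_eq_mul]; ring)
    (fun _ _ _ => by simp only [map_add]; ring)
    (fun _ _ _ => by simp only [map_smul, smul_eq_mul]; ring)

variable (EC) in
/-- The product of the left-invariant differentials of two functions. -/
def leftDerivProduct (φ ψ : GC → ℂ) (z : GC) : EC →ₗ[ℂ] EC →ₗ[ℂ] ℂ :=
  LinearMap.mk₂ ℂ (fun Z Z' => leftDeriv ℂ EC φ z Z * leftDeriv ℂ EC ψ z Z')
    (fun _ _ _ => by simp only [map_add]; ring)
    (fun _ _ _ => by simp only [map_smul, smul_eq_mul]; ring)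
    (fun _ _ _ => by simp only [map_add]; ring)
    (fun _ _ _ => by simp only [map_smul, smul_eq_mul]; ring)

/-- The family `φ` is a holomorphic eigenfamily on `s` for the left-invariant holomorphic metric
`BC`. -/
def IsHolomorphicEigenfamily {A κ : Type*} [Fintype κ] [DecidableEq κ] (b : Module.Basis κ ℂ EC)
    (BC : LinearMap.BilinForm ℂ EC) (s : Set GC) (φ : A → GC → ℂ) (lam mu : ℂ) : Prop :=
  (∀ i, ∀ z ∈ s, metricTrace b BC (leftHessian EC (φ i) z) = lam * φ i z) ∧
  (∀ i j, ∀ z ∈ s, metricTrace b BC (leftDerivProduct EC (φ i) (φ j) z) = mu * φ i z * φ j z)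

section Regularity

variable [LieGroup 𝓘(ℂ, EC) ω GC]

theorem contMDiffAt_leftHessian {φ : GC → ℂ} {z : GC}
    (hφ : ContMDiffAt 𝓘(ℂ, EC) 𝓘(ℂ, ℂ) ω φ z) (Z Z' : EC) :
    ContMDiffAt 𝓘(ℂ, EC) 𝓘(ℂ, ℂ) ω (fun w => leftHessian EC φ w Z Z') z := by
  have h1 := contMDiffAt_leftDeriv hφ
  have h2 := contMDiffAt_leftDeriv h1
  exact ((h2.clm_apply contMDiffAt_const).clm_apply contMDiffAt_const).sub
    (contMDiffAt_const_mul _ (h1.clm_apply contMDiffAt_const))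

theorem contMDiffAt_leftDerivProduct {φ ψ : GC → ℂ} {z : GC}
    (hφ : ContMDiffAt 𝓘(ℂ, EC) 𝓘(ℂ, ℂ) ω φ z) (hψ : ContMDiffAt 𝓘(ℂ, EC) 𝓘(ℂ, ℂ) ω ψ z)
    (Z Z' : EC) :
    ContMDiffAt 𝓘(ℂ, EC) 𝓘(ℂ, ℂ) ω (fun w => leftDerivProduct EC φ ψ w Z Z') z :=
  ((contMDiffAt_leftDeriv hφ).clm_apply contMDiffAt_const).smul
    ((contMDiffAt_leftDeriv hψ).clm_apply contMDiffAt_const)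

end Regularity

/-- A holomorphic function vanishing on an open subset of a real form vanishes identically. -/
theorem eq_zero_of_comp_hom_eq_zero [FiniteDimensional ℂ EC] [LieGroup 𝓘(ℝ, E) ω H]
    [LieGroup 𝓘(ℂ, EC) ω GC] {f : H →* GC} (hf : ContMDiff 𝓘(ℝ, E) 𝓘(ℝ, EC) ω f)
    (hd : Function.Bijective fun q : E × E =>
      homDifferential (EC := EC) f q.1 + Complex.I • homDifferential (EC := EC) f q.2)
    {WC : Set GC} {h : GC → ℂ}
    (hh : ∀ z ∈ WC, ContMDiffAt 𝓘(ℂ, EC) 𝓘(ℂ, ℂ) ω h z)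
    {W : Set H} (hW : IsOpen W) (hWC : ∀ x ∈ W, f x ∈ WC)
    (hcomp : ∀ z ∈ WC, (connectedComponentIn WC z ∩ f '' W).Nonempty)
    (h0 : ∀ x ∈ W, h (f x) = 0) : ∀ z ∈ WC, h z = 0 := by
  intro z hz
  obtain ⟨_, hxz, x, hx, rfl⟩ := hcomp z hz
  have : ContinuousMul H := continuousMul_of_contMDiffMul 𝓘(ℝ, E) ω
  refine eq_zero_of_mem_connectedComponentIn hh hz hxz ?_
  -- The stable family consists of all holomorphic functions on `WC` vanishing on f(W); openness of
  -- W makes it closed under derivatives along the real form.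
  refine eventually_eq_zero_of_leftDeriv_stable (f x)
    {h | (∀ z ∈ WC, ContMDiffAt 𝓘(ℂ, EC) 𝓘(ℂ, ℂ) ω h z) ∧ ∀ x ∈ W, h (f x) = 0}
    (fun h hh => hh.1 _ (hWC x hx)) (fun h hh => hh.2 x hx) ?_ ⟨hh, h0⟩
  rintro k ⟨hk, hk0⟩ Z
  refine ⟨fun w hw => (contMDiffAt_leftDeriv (hk w hw)).clm_apply contMDiffAt_const, ?_⟩
  intro y hy
  have hd0 : ∀ X : E, leftDeriv ℂ EC k (f y) (homDifferential f X) = 0 := by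
    intro X
    rw [← leftDeriv_comp_hom hf (hk _ (hWC y hy)) X]
    have hev : (fun z => k (f z)) =ᶠ[nhds y] fun _ => (0 : ℂ) := by
      filter_upwards [hW.mem_nhds hy] with w hw using hk0 w hw
    rw [leftDeriv_congr hev]
    simp [leftDeriv]
  -- Every direction is X + iY with X, Y tangent to the real form, and the derivative is complex
  -- linear.
  obtain ⟨q, rfl⟩ := hd.2 Z
  simp [hd0]

variable [FiniteDimensional ℝ E] [LieGroup 𝓘(ℝ, E) ω H] [LieGroup 𝓘(ℂ, EC) ω GC] {f : H →* GC} (hf : ContMDiff 𝓘(ℝ, E) 𝓘(ℝ, EC) ω f)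
  (hd : Function.Bijective fun q : E × E =>
    homDifferential (EC := EC) f q.1 + Complex.I • homDifferential (EC := EC) f q.2)
  {B : LinearMap.BilinForm ℝ E} (hsymm : ∀ X Y, B X Y = B Y X) {BC : LinearMap.BilinForm ℂ EC}
  {s : ℝ} (hs : s * s = 1)
  (hBC : ∀ X Y, BC (homDifferential f X) (homDifferential f Y) = ((s * B X Y : ℝ) : ℂ))
  (hnd : BC.Nondegenerate) {κ : Type*} [Fintype κ] [DecidableEq κ] (b : Module.Basis κ ℂ EC)

include hf hd hsymm hs hBC hnd

/-- In the basis induced by the chart at x, the holomorphic trace is s times the real one;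
derivatives, trace of ad and Gram matrix correspond term by term. -/
theorem laplacian_eq_metricTrace {φ : GC → ℂ} {ψ : H → ℂ} {x : H}
    (hφ : ContMDiffAt 𝓘(ℂ, EC) 𝓘(ℂ, ℂ) ω φ (f x)) (hψ : ψ =ᶠ[nhds x] fun z => φ (f z)) :
    laplacian (leftInvariantMetric (EG := E) (G := H) B) ψ x
      = s * metricTrace b BC (leftHessian EC φ (f x)) := by
  have : ContinuousMul H := continuousMul_of_contMDiffMul 𝓘(ℝ, E) ω
  have hψ' : ContMDiffAt 𝓘(ℝ, E) 𝓘(ℝ, ℂ) ω ψ x :=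
    (contMDiffAt_comp_hom hf hφ).congr_of_eventuallyEq hψ
  have hu := isUnit_toMatrix_of_complexified _ hd (coframeBasis x) B BC s hBC hnd
  have hub : IsUnit (LinearMap.BilinForm.toMatrix b BC) := by
    rw [Matrix.isUnit_iff_isUnit_det, isUnit_iff_ne_zero]
    exact (LinearMap.BilinForm.nondegenerate_iff_det_ne_zero b).1 hnd
  have hss : (s : ℂ) * s = 1 := by exact_mod_cast hs
  rw [metricTrace_basis_independent b (complexBasis _ hd (coframeBasis x)) BC _ hub,
    metricTrace_complexBasis _ hd _ B BC s hs hBC hnd, ← mul_assoc, hss, one_mul,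
    laplacian_leftInvariantMetric B hsymm hψ' hu]
  refine Finset.sum_congr rfl fun i _ => Finset.sum_congr rfl fun j _ => ?_
  congr 1
  have h1 : (fun z => leftDeriv ℝ E ψ z (coframeBasis x j)) =ᶠ[nhds x]
      fun z => leftDeriv ℝ E (fun w => φ (f w)) z (coframeBasis x j) := by
    filter_upwards [hψ.eventuallyEq_nhds] with z hz
    rw [leftDeriv_congr hz]
  rw [leftDeriv_congr h1, leftDeriv_leftDeriv_comp_hom hf hφ, leftDeriv_congr hψ,
    leftDeriv_comp_hom hf hφ, ← trace_complexification (homDifferential f) hd (coframeBasis x) _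
      (complexBracket EC GC (homDifferential f (coframeBasis x i)))
      (homDifferential_frameBracket hf x (coframeBasis x i))]
  rfl

theorem kappa_eq_metricTrace {φ φ' : GC → ℂ} {ψ ψ' : H → ℂ} {x : H}
    (hφ : ContMDiffAt 𝓘(ℂ, EC) 𝓘(ℂ, ℂ) ω φ (f x)) (hψ : ψ =ᶠ[nhds x] fun z => φ (f z))
    (hφ' : ContMDiffAt 𝓘(ℂ, EC) 𝓘(ℂ, ℂ) ω φ' (f x)) (hψ' : ψ' =ᶠ[nhds x] fun z => φ' (f z)) :
    kappa (leftInvariantMetric (EG := E) (G := H) B) ψ ψ' x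
      = s * metricTrace b BC (leftDerivProduct EC φ φ' (f x)) := by
  have : ContinuousMul H := continuousMul_of_contMDiffMul 𝓘(ℝ, E) ω
  have hu := isUnit_toMatrix_of_complexified _ hd (coframeBasis x) B BC s hBC hnd
  have hub : IsUnit (LinearMap.BilinForm.toMatrix b BC) := by
    rw [Matrix.isUnit_iff_isUnit_det, isUnit_iff_ne_zero]
    exact (LinearMap.BilinForm.nondegenerate_iff_det_ne_zero b).1 hnd
  have hss : (s : ℂ) * s = 1 := by exact_mod_cast hs
  rw [metricTrace_basis_independent b (complexBasis _ hd (coframeBasis x)) BC _ hub,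
    metricTrace_complexBasis _ hd _ B BC s hs hBC hnd, ← mul_assoc, hss, one_mul,
    kappa_leftInvariantMetric B hsymm ((contMDiffAt_comp_hom hf hφ).congr_of_eventuallyEq hψ)
      ((contMDiffAt_comp_hom hf hφ').congr_of_eventuallyEq hψ') hu]
  refine Finset.sum_congr rfl fun i _ => Finset.sum_congr rfl fun j _ => ?_
  rw [leftDeriv_congr hψ, leftDeriv_congr hψ', leftDeriv_comp_hom hf hφ, leftDeriv_comp_hom hf hφ']
  rfl

theorem IsHolomorphicEigenfamily.isEigenfamilyWith {A : Type*} {WC : Set GC} {φ : A → GC → ℂ}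
    (hφ : ∀ i, ∀ z ∈ WC, ContMDiffAt 𝓘(ℂ, EC) 𝓘(ℂ, ℂ) ω (φ i) z)
    {W : Set H} (hW : IsOpen W) (hWC : ∀ x ∈ W, f x ∈ WC) {ψ : A → H → ℂ}
    (hψ : ∀ i, ∀ x ∈ W, φ i (f x) = ψ i x) {lam mu : ℂ}
    (h : IsHolomorphicEigenfamily b BC WC φ lam mu) :
    IsEigenfamilyWith (leftInvariantMetric (EG := E) (G := H) B) W ψ (s * lam) (s * mu) := by
  have hev : ∀ i, ∀ x ∈ W, ψ i =ᶠ[nhds x] fun z => φ i (f z) := fun i x hx => by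
    filter_upwards [hW.mem_nhds hx] with z hz using (hψ i z hz).symm
  refine ⟨fun i x hx => ?_, fun i j x hx => ?_⟩
  · rw [laplacian_eq_metricTrace hf hd hsymm hs hBC hnd b (hφ i _ (hWC x hx)) (hev i x hx),
      h.1 i _ (hWC x hx), hψ i x hx, mul_assoc]
  · rw [kappa_eq_metricTrace hf hd hsymm hs hBC hnd b (hφ i _ (hWC x hx)) (hev i x hx)
      (hφ j _ (hWC x hx)) (hev j x hx), h.2 i j _ (hWC x hx), hψ i x hx, hψ j x hx]
    ring

/-- The defect of each equation is holomorphic on `WC` and vanishes on f(W), so the identity theorem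
applies to it. -/
theorem IsEigenfamilyWith.isHolomorphicEigenfamily [FiniteDimensional ℂ EC] {A : Type*}
    {WC : Set GC} {φ : A → GC → ℂ}
    (hφ : ∀ i, ∀ z ∈ WC, ContMDiffAt 𝓘(ℂ, EC) 𝓘(ℂ, ℂ) ω (φ i) z)
    {W : Set H} (hW : IsOpen W) (hWC : ∀ x ∈ W, f x ∈ WC)
    (hcomp : ∀ z ∈ WC, (connectedComponentIn WC z ∩ f '' W).Nonempty) {ψ : A → H → ℂ}
    (hψ : ∀ i, ∀ x ∈ W, φ i (f x) = ψ i x) {lam mu : ℂ}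
    (h : IsEigenfamilyWith (leftInvariantMetric (EG := E) (G := H) B) W ψ (s * lam) (s * mu)) :
    IsHolomorphicEigenfamily b BC WC φ lam mu := by
  have hev : ∀ i, ∀ x ∈ W, ψ i =ᶠ[nhds x] fun z => φ i (f z) := fun i x hx => by
    filter_upwards [hW.mem_nhds hx] with z hz using (hψ i z hz).symm
  have hss : (s : ℂ) ≠ 0 := by
    rintro h0
    rw [Complex.ofReal_eq_zero] at h0
    simp [h0] at hs
  refine ⟨fun i z hz => ?_, fun i j z hz => ?_⟩
  · refine sub_eq_zero.1 (eq_zero_of_comp_hom_eq_zero hf hd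
      (h := fun z => metricTrace b BC (leftHessian EC (φ i) z) - lam * φ i z) (fun z hz =>
        (contMDiffAt_metricTrace b BC (contMDiffAt_leftHessian (hφ i z hz))).sub
          (contMDiffAt_const_mul _ (hφ i z hz))) hW hWC hcomp (fun x hx => ?_) z hz)
    have h1 := h.1 i x hx
    rw [laplacian_eq_metricTrace hf hd hsymm hs hBC hnd b (hφ i _ (hWC x hx)) (hev i x hx),
      mul_assoc, ← hψ i x hx] at h1
    exact sub_eq_zero.2 (mul_left_cancel₀ hss h1)
  · refine sub_eq_zero.1 (eq_zero_of_comp_hom_eq_zero hf hd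
      (h := fun z => metricTrace b BC (leftDerivProduct EC (φ i) (φ j) z) - mu * φ i z * φ j z)
      (fun z hz =>
        (contMDiffAt_metricTrace b BC (contMDiffAt_leftDerivProduct (hφ i z hz) (hφ j z hz))).sub
          ((contMDiffAt_const_mul _ (hφ i z hz)).smul (hφ j z hz))) hW hWC hcomp
      (fun x hx => ?_) z hz)
    have h1 := h.2 i j x hx
    rw [kappa_eq_metricTrace hf hd hsymm hs hBC hnd b (hφ i _ (hWC x hx)) (hev i x hx)
      (hφ j _ (hWC x hx)) (hev j x hx), mul_assoc, mul_assoc, ← hψ i x hx, ← hψ j x hx] at h1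
    rw [sub_eq_zero, mul_assoc]
    exact mul_left_cancel₀ hss h1

end Eigen

/-! ### The dual real form and its scalar product -/

section AdaptedForm

variable {V : Type*} [AddCommGroup V] [Module ℝ V]

/-- Pair v with its own components in k and p: orthogonality isolates each square, and definiteness
kills it. -/
theorem IsAdaptedScalarProduct.eq_zero {k p : Submodule ℝ V} {B : LinearMap.BilinForm ℝ V}
    (hkp : IsCompl k p) (hB : IsAdaptedScalarProduct k p B) {v : V} (hv : ∀ w, B v w = 0) :
    v = 0 := by
  obtain ⟨y, hy, x, hx, rfl⟩ := Submodule.mem_sup.1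
    (hkp.sup_eq_top ▸ Submodule.mem_top : v ∈ k ⊔ p)
  have h1 : y = 0 := by
    by_contra hne
    have h2 := hv y
    rw [map_add, LinearMap.add_apply, hB.symm x y, hB.orthogonal y hy x hx, add_zero] at h2
    exact (hB.neg y hy hne).ne h2
  have h2 : x = 0 := by
    by_contra hne
    have h2 := hv x
    rw [map_add, LinearMap.add_apply, hB.orthogonal y hy x hx, zero_add] at h2
    exact (hB.pos x hx hne).ne' h2
  rw [h1, h2, add_zero]

theorem IsAdaptedScalarProduct.nondegenerate {k p : Submodule ℝ V} {B : LinearMap.BilinForm ℝ V}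
    (hkp : IsCompl k p) (hB : IsAdaptedScalarProduct k p B) : B.Nondegenerate :=
  ⟨fun _ hv => hB.eq_zero hkp hv, fun v hv => hB.eq_zero hkp fun w => by rw [hB.symm]; exact hv w⟩

variable {VC : Type*} [AddCommGroup VC] [Module ℂ VC] [Module ℝ VC]

/-- The subspace `k + i p` is again a real form when `V = k ⊕ p`. -/
theorem bijective_complexification_of_dual {V' : Type*} [AddCommGroup V'] [Module ℝ V']
    (d : V →ₗ[ℝ] VC) (hd : Function.Bijective fun q : V × V => d q.1 + Complex.I • d q.2)
    {k p : Submodule ℝ V} (hkp : IsCompl k p) (d' : V' →ₗ[ℝ] VC) (hinj : Function.Injective d')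
    (hrange : ∀ z, (∃ u, d' u = z) ↔ ∃ y ∈ k, ∃ x ∈ p, z = d y + Complex.I • d x) :
    Function.Bijective fun q : V' × V' => d' q.1 + Complex.I • d' q.2 := by
  have hI : ∀ z : VC, Complex.I • Complex.I • z = -z := fun z => by
    rw [smul_smul, Complex.I_mul_I, neg_one_smul]
  constructor
  · rintro ⟨u, v⟩ ⟨u', v'⟩ h
    obtain ⟨y, hy, x, hx, h1⟩ := (hrange _).1 ⟨u - u', rfl⟩
    obtain ⟨y', hy', x', hx', h2⟩ := (hrange _).1 ⟨v - v', rfl⟩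
    -- Collects (y + ix) + i(y' + ix') = 0 into real and imaginary parts. Then y = x' and y' = −x
    -- lie in k ∩ p = 0.
    have h3 : d (y - x') + Complex.I • d (x + y') = d 0 + Complex.I • d 0 := by
      have h4 : d' (u - u') + Complex.I • d' (v - v') = 0 := by
        simp only [map_sub, smul_sub]
        rw [← add_sub_add_comm]
        exact sub_eq_zero.2 h
      rw [h1, h2, smul_add, hI] at h4
      simp only [map_sub, map_add, smul_add, map_zero, smul_zero, add_zero]
      rw [← h4]
      abel
    have h5 := @hd.1 (y - x', x + y') (0, 0) h3
    rw [Prod.mk.injEq] at h5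
    have h6 : y = 0 := by
      have : y = x' := sub_eq_zero.1 h5.1
      exact (Submodule.disjoint_def.1 hkp.disjoint) y hy (this ▸ hx')
    have h7 : y' = 0 := by
      have : y' = -x := by rw [eq_neg_iff_add_eq_zero, add_comm]; exact h5.2
      exact (Submodule.disjoint_def.1 hkp.disjoint) y' hy' (this ▸ p.neg_mem hx)
    have h8 : x' = 0 := by simpa [h6] using h5.1
    have h9 : x = 0 := by simpa [h7] using h5.2
    have h10 : u - u' = 0 := hinj (by rw [h1, h6, h9]; simp)
    have h11 : v - v' = 0 := hinj (by rw [h2, h7, h8]; simp)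
    rw [sub_eq_zero.1 h10, sub_eq_zero.1 h11]
  · intro z
    obtain ⟨⟨a, c⟩, rfl⟩ := hd.2 z
    obtain ⟨y, hy, x, hx, rfl⟩ := Submodule.mem_sup.1
      (hkp.sup_eq_top ▸ Submodule.mem_top : a ∈ k ⊔ p)
    obtain ⟨y', hy', x', hx', rfl⟩ := Submodule.mem_sup.1
      (hkp.sup_eq_top ▸ Submodule.mem_top : c ∈ k ⊔ p)
    -- The witnesses come from (y + x) + i(y' + x') = (y + ix') + i(y' − ix).
    obtain ⟨u, hu⟩ := (hrange _).2 ⟨y, hy, x', hx', rfl⟩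
    obtain ⟨v, hv⟩ := (hrange _).2 ⟨y', hy', -x, p.neg_mem hx, rfl⟩
    refine ⟨(u, v), ?_⟩
    simp only [hu, hv, map_add, map_neg, smul_add, smul_neg, hI]
    abel

variable [IsScalarTower ℝ ℂ VC]

theorem nondegenerate_of_complexified {ι : Type*} [Fintype ι] [DecidableEq ι] (d : V →ₗ[ℝ] VC)
    (hd : Function.Bijective fun q : V × V => d q.1 + Complex.I • d q.2)
    (b : Module.Basis ι ℝ V) {B : LinearMap.BilinForm ℝ V} {BC : LinearMap.BilinForm ℂ VC}
    (hBC : ∀ X Y, BC (d X) (d Y) = (B X Y : ℂ)) (hnd : B.Nondegenerate) : BC.Nondegenerate := by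
  rw [LinearMap.BilinForm.nondegenerate_iff_det_ne_zero (complexBasis d hd b),
    toMatrix_complexBasis d hd b B BC 1 (by simpa using hBC), one_smul, ← RingHom.mapMatrix_apply,
    ← RingHom.map_det]
  exact fun h0 => (LinearMap.BilinForm.nondegenerate_iff_det_ne_zero b).1 hnd
    (Complex.ofReal_eq_zero.1 h0)

end AdaptedForm

section Dual

variable {EG : Type*} [NormedAddCommGroup EG] [NormedSpace ℝ EG]
variable {G : Type*} [TopologicalSpace G] [ChartedSpace EG G] [Group G]
variable {EU : Type*} [NormedAddCommGroup EU] [NormedSpace ℝ EU]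
variable {U : Type*} [TopologicalSpace U] [ChartedSpace EU U] [Group U]
variable {EC : Type*} [NormedAddCommGroup EC] [NormedSpace ℂ EC]
variable {GC : Type*} [TopologicalSpace GC] [ChartedSpace EC GC] [Group GC]

theorem dualForm_symm {ι : G →* GC} (hι : IsComplexification (EG := EG) (EC := EC) ι) (j : U →* GC)
    {B : LinearMap.BilinForm ℝ (GroupLieAlgebra 𝓘(ℝ, EG) G)} (hB : ∀ X Y, B X Y = B Y X)
    (u v : GroupLieAlgebra 𝓘(ℝ, EU) U) :
    dualForm (EU := EU) hι j B u v = dualForm (EU := EU) hι j B v u :=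
  congrArg₂ (· - ·) (hB _ _) (hB _ _)

/-- For y + ix and y' + ix' with y, y' in k and x, x' in p, the imaginary part B(y,x') + B(x,y')
vanishes by orthogonality, and the real part B(y,y') − B(x,x') is minus the dual product. -/
theorem complexified_dualForm {ι : G →* GC} (hι : IsComplexification (EG := EG) (EC := EC) ι)
    {k p : Submodule ℝ (GroupLieAlgebra 𝓘(ℝ, EG) G)} {j : U →* GC}
    (hj : IsCompactDual (EU := EU) (EC := EC) ι k p j)
    {B : LinearMap.BilinForm ℝ (GroupLieAlgebra 𝓘(ℝ, EG) G)} (hB : IsAdaptedScalarProduct k p B)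
    {BC : LinearMap.BilinForm ℂ EC}
    (hBC : ∀ X Y : EG, BC (homDifferential ι X) (homDifferential ι Y)
      = ((B : LinearMap.BilinForm ℝ EG) X Y : ℂ)) (u v : EU) :
    BC (homDifferential j u) (homDifferential j v)
      = (((-1 : ℝ) * (dualForm (EU := EU) hι j B : LinearMap.BilinForm ℝ EU) u v : ℝ) : ℂ) := by
  obtain ⟨y, hy, x, hx, h1⟩ := (hj.range_eq _).1 ⟨u, rfl⟩
  obtain ⟨y', hy', x', hx', h2⟩ := (hj.range_eq _).1 ⟨v, rfl⟩
  have hsymm : ∀ {w : EU} {a c : GroupLieAlgebra 𝓘(ℝ, EG) G},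
      differentialAtOne (EG := EU) (EC := EC) j w
        = differentialAtOne ι a + Complex.I • differentialAtOne ι c →
      (LinearEquiv.ofBijective (complexifiedDifferential ι) hι.bijective).symm
        (differentialAtOne (EG := EU) (EC := EC) j w) = (a, c) := by
    intro w a c h
    rw [LinearEquiv.symm_apply_eq, h]
    rfl
  have hdual : (dualForm (EU := EU) hι j B : LinearMap.BilinForm ℝ EU) u v = B x x' - B y y' := by
    have h3 := hsymm h1
    have h4 := hsymm h2
    change B ((LinearEquiv.ofBijective (complexifiedDifferential ι) hι.bijective).symm
        (differentialAtOne (EG := EU) (EC := EC) j u)).2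
        ((LinearEquiv.ofBijective (complexifiedDifferential ι) hι.bijective).symm
        (differentialAtOne (EG := EU) (EC := EC) j v)).2
      - B ((LinearEquiv.ofBijective (complexifiedDifferential ι) hι.bijective).symm
        (differentialAtOne (EG := EU) (EC := EC) j u)).1
        ((LinearEquiv.ofBijective (complexifiedDifferential ι) hι.bijective).symm
        (differentialAtOne (EG := EU) (EC := EC) j v)).1 = _
    rw [h3, h4]
  have hexp : ∀ a c a' c' : EG, BC (homDifferential ι a + Complex.I • homDifferential ι c)
      (homDifferential ι a' + Complex.I • homDifferential ι c')
        = ((B : LinearMap.BilinForm ℝ EG) a a' : ℂ) - (B : LinearMap.BilinForm ℝ EG) c c'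
          + Complex.I * ((B : LinearMap.BilinForm ℝ EG) a c' + (B : LinearMap.BilinForm ℝ EG) c a')
      := by
    intro a c a' c'
    simp only [map_add, map_smul, LinearMap.add_apply, LinearMap.smul_apply, smul_eq_mul, hBC]
    linear_combination ((B : LinearMap.BilinForm ℝ EG) c c' : ℂ) * Complex.I_mul_I
  have h5 : BC (homDifferential j u) (homDifferential j v) = (B y y' : ℂ) - B x x'
      + Complex.I * (B y x' + B x y') :=
    (congrArg₂ (fun z w => BC z w) h1 h2).trans (hexp y x y' x')
  have h7 : B y x' = 0 := hB.orthogonal y hy x' hx'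
  have h8 : B x y' = 0 := by rw [hB.symm]; exact hB.orthogonal y' hy' x hx
  rw [h5, hdual, h7, h8]
  push_cast
  ring

end Dual

end

/-! ### The duality theorem -/

theorem theorem7p1
    {EG : Type*} [NormedAddCommGroup EG] [NormedSpace ℝ EG] [FiniteDimensional ℝ EG]
    [CompleteSpace EG]
    {EU : Type*} [NormedAddCommGroup EU] [NormedSpace ℝ EU] [FiniteDimensional ℝ EU]
    {EC : Type*} [NormedAddCommGroup EC] [NormedSpace ℂ EC] [FiniteDimensional ℂ EC]
    {G : Type*} [TopologicalSpace G] [ChartedSpace EG G] [Group G] [LieGroup 𝓘(ℝ, EG) ω G]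
    [NoncompactSpace G] [LieAlgebra.IsSemisimple ℝ (GroupLieAlgebra 𝓘(ℝ, EG) G)]
    {U : Type*} [TopologicalSpace U] [ChartedSpace EU U] [Group U] [LieGroup 𝓘(ℝ, EU) ω U]
    [CompactSpace U]
    {GC : Type*} [TopologicalSpace GC] [ChartedSpace EC GC] [Group GC] [LieGroup 𝓘(ℂ, EC) ω GC]
    (ι : G →* GC) (hι : IsComplexification (EG := EG) (EC := EC) ι)
    (k p : Submodule ℝ (GroupLieAlgebra 𝓘(ℝ, EG) G)) (hkp : IsCartanDecomposition k p)
    (j : U →* GC) (hj : IsCompactDual (EU := EU) (EC := EC) ι k p j)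
    (B : LinearMap.BilinForm ℝ (GroupLieAlgebra 𝓘(ℝ, EG) G)) (hB : IsAdaptedScalarProduct k p B)
    {A : Type*} (φ : A → G → ℂ) (W : Set G) (hW : IsOpen W)
    (hφ : ∀ i, ContMDiffOn 𝓘(ℝ, EG) 𝓘(ℝ, ℂ) ω (φ i) W)
    (φC : A → GC → ℂ) (WC : Set GC) (hWC : IsOpen WC)
    (hext : ∀ i, IsHolomorphicExtension (EC := EC) ι W (φ i) WC (φC i))
    (hcompG : ∀ z ∈ WC, (connectedComponentIn WC z ∩ ι '' W).Nonempty) :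
    (∀ lam mu : ℂ, IsEigenfamilyWith (leftInvariantMetric B) W φ lam mu →
      IsEigenfamilyWith (leftInvariantMetric (dualForm (EU := EU) hι j B)) (j ⁻¹' WC)
        (fun i => φC i ∘ j) (-lam) (-mu)) ∧
    ((∀ z ∈ WC, (connectedComponentIn WC z ∩ Set.range j).Nonempty) →
      (∀ lam mu : ℂ, IsEigenfamilyWith (leftInvariantMetric B) W φ lam mu ↔
        IsEigenfamilyWith (leftInvariantMetric (dualForm (EU := EU) hι j B)) (j ⁻¹' WC)
          (fun i => φC i ∘ j) (-lam) (-mu)) ∧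
      (IsEigenfamily (leftInvariantMetric B) W φ ↔
        IsEigenfamily (leftInvariantMetric (dualForm (EU := EU) hι j B)) (j ⁻¹' WC)
          (fun i => φC i ∘ j))) := by
  have hdG : Function.Bijective fun q : EG × EG =>
      homDifferential (EC := EC) ι q.1 + Complex.I • homDifferential (EC := EC) ι q.2 :=
    hι.bijective
  have hdU : Function.Bijective fun q : EU × EU =>
      homDifferential (EC := EC) j q.1 + Complex.I • homDifferential (EC := EC) j q.2 :=
    bijective_complexification_of_dual (homDifferential ι) hdG hkp.isCompl
      (homDifferential (E := EU) j) hj.immersion hj.range_eq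
  obtain ⟨BC, hBC⟩ := exists_complexified_bilinForm (homDifferential (EC := EC) ι) hdG
    (Module.finBasis ℝ EG) B
  have hnd : BC.Nondegenerate := nondegenerate_of_complexified (homDifferential ι) hdG
    (Module.finBasis ℝ EG) hBC (hB.nondegenerate hkp.isCompl)
  have hBU := complexified_dualForm (EU := EU) hι hj hB hBC
  have hsU := dualForm_symm (EU := EU) hι j hB.symm
  let b := Module.finBasis ℂ EC
  have hreg : ∀ i, ∀ z ∈ WC, ContMDiffAt 𝓘(ℂ, EC) 𝓘(ℂ, ℂ) ω (φC i) z := fun i z hz =>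
    (hext i).holomorphic.contMDiffAt (hWC.mem_nhds hz)
  -- The inclusion of ι(W) in `WC` is part of the extension data of each member, so the empty family
  -- is treated apart; there all claims are vacuous.
  rcases isEmpty_or_nonempty A with hA | ⟨⟨i₀⟩⟩
  · have htrivG : ∀ lam mu : ℂ, IsEigenfamilyWith (leftInvariantMetric B) W φ lam mu := fun _ _ =>
      ⟨fun i => isEmptyElim i, fun i => isEmptyElim i⟩
    have htrivU : ∀ lam mu : ℂ, IsEigenfamilyWith (leftInvariantMetric (dualForm (EU := EU) hι j B))
        (j ⁻¹' WC) (fun i => φC i ∘ j) lam mu := fun _ _ =>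
      ⟨fun i => isEmptyElim i, fun i => isEmptyElim i⟩
    exact ⟨fun _ _ _ => htrivU _ _, fun _ => ⟨fun _ _ => ⟨fun _ => htrivU _ _, fun _ => htrivG _ _⟩,
      ⟨fun _ => ⟨0, 0, htrivU _ _⟩, fun _ => ⟨0, 0, htrivG _ _⟩⟩⟩⟩
  have hWι : ∀ x ∈ W, ι x ∈ WC := fun x hx => (hext i₀).image_subset ⟨x, hx, rfl⟩
  have hWj : IsOpen (j ⁻¹' WC) := hWC.preimage hj.contMDiff.continuous
  have hBG : ∀ X Y : EG, BC (homDifferential ι X) (homDifferential ι Y)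
      = (((1 : ℝ) * (B : LinearMap.BilinForm ℝ EG) X Y : ℝ) : ℂ) := by
    intro X Y
    rw [one_mul]
    exact hBC X Y
  have hG1 : ∀ lam mu : ℂ, IsEigenfamilyWith (leftInvariantMetric B) W φ lam mu →
      IsHolomorphicEigenfamily b BC WC φC lam mu := fun lam mu h =>
    IsEigenfamilyWith.isHolomorphicEigenfamily hι.contMDiff hdG hB.symm (mul_one 1) hBG hnd b hreg
      hW hWι hcompG (fun i => (hext i).extends_eq) (by simpa only [Complex.ofReal_one, one_mul] using h)
  have hG2 : ∀ lam mu : ℂ, IsHolomorphicEigenfamily b BC WC φC lam mu →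
      IsEigenfamilyWith (leftInvariantMetric B) W φ lam mu := fun lam mu h => by
    have h1 := h.isEigenfamilyWith hι.contMDiff hdG hB.symm (mul_one 1) hBG hnd b hreg hW hWι
      (fun i => (hext i).extends_eq)
    simpa only [Complex.ofReal_one, one_mul] using h1
  have hU2 : ∀ lam mu : ℂ, IsHolomorphicEigenfamily b BC WC φC lam mu →
      IsEigenfamilyWith (leftInvariantMetric (dualForm (EU := EU) hι j B)) (j ⁻¹' WC)
        (fun i => φC i ∘ j) (-lam) (-mu) := fun lam mu h => by
    have h1 := h.isEigenfamilyWith hj.contMDiff hdU hsU (by norm_num) hBU hnd b hreg hWj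
      (fun x hx => hx) (ψ := fun i => φC i ∘ j) (fun i x _ => rfl)
    simpa only [Complex.ofReal_neg, Complex.ofReal_one, neg_one_mul] using h1
  refine ⟨fun lam mu h => hU2 _ _ (hG1 _ _ h), fun hcompU => ?_⟩
  -- A point of the dual group in a component of `WC` lies in `WC`, hence comes from the open set `j
  -- ⁻¹' WC`.
  have hcompU' : ∀ z ∈ WC, (connectedComponentIn WC z ∩ j '' (j ⁻¹' WC)).Nonempty := by
    intro z hz
    obtain ⟨_, hw, u, rfl⟩ := hcompU z hz
    exact ⟨j u, hw, u, connectedComponentIn_subset WC z hw, rfl⟩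
  have hU1 : ∀ lam mu : ℂ,
      IsEigenfamilyWith (leftInvariantMetric (dualForm (EU := EU) hι j B)) (j ⁻¹' WC)
        (fun i => φC i ∘ j) (-lam) (-mu) → IsHolomorphicEigenfamily b BC WC φC lam mu :=
    fun lam mu h =>
    IsEigenfamilyWith.isHolomorphicEigenfamily hj.contMDiff hdU hsU (by norm_num) hBU hnd b hreg
      hWj (fun x hx => hx) hcompU' (ψ := fun i => φC i ∘ j) (fun i x _ => rfl)
      (by simpa only [Complex.ofReal_neg, Complex.ofReal_one, neg_one_mul] using h)
  refine ⟨fun lam mu => ⟨fun h => hU2 _ _ (hG1 _ _ h), fun h => hG2 _ _ (hU1 _ _ h)⟩, ?_, ?_⟩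
  · rintro ⟨lam, mu, h⟩
    exact ⟨-lam, -mu, hU2 _ _ (hG1 _ _ h)⟩
  · rintro ⟨lam, mu, h⟩
    -- The given eigenvalues are rewritten as −(−λ), −(−μ) to match the form of `hU1`.
    exact ⟨-lam, -mu, hG2 _ _ (hU1 _ _ (by simpa only [neg_neg] using h))⟩
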